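/- Let $\mathcal A=\{0,1,2\}$. Let $R$ be the antimorphism of $\mathcal A^*$ (that is, $\vartheta(uv)=\vartheta(v)\vartheta(u)$) that fixes every letter, and for $i\in\mathcal A$ let $E_i$ be the antimorphism that fixes $i$ and exchanges the two other letters. A word $v$ is a $\vartheta$-palindrome if $\vartheta(v)=v$, and a pseudopalindrome if it is a $\vartheta$-palindrome for some $\vartheta\in\{R,E_0,E_1,E_2\}$; $v^{\vartheta}$ denotes the shortest $\vartheta$-palindrome that has $v$ as a prefix. For a directive bi-sequence $(\Delta,\Theta)=(\delta_1\delta_2\cdots,\vartheta_1\vartheta_2\cdots)$ with $\delta_m\in\mathcal A$ and $\vartheta_m\in\{R,E_0,E_1,E_2\}$, put $w_0=\varepsilon$ and $w_{m+1}=(w_m\delta_{m+1})^{\vartheta_{m+1}}$, and let $\mathbf u(\Delta,\Theta)$ be the infinite word that has all the $w_m$ as prefixes. The prefix of length $n$ of $(\Delta,\Theta)$ is called normalized if every pseudopalindromic prefix of $w_n$ is one of $w_0,\dots,w_n$ and, for the longest prefix of $w_n$ of the form $i^l$ with $i\in\mathcal A$, the first $l$ terms of $\Theta$ are all $E_i$.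 A pseudopalindromic prefix of $\mathbf u(\Delta,\Theta)$ whose length is strictly between $|w_n|$ and $|w_{n+1}|$ is said to be missed between $w_n$ and $w_{n+1}$. Theorem. Let $n\ge 0$ and let $(\Delta,\Theta)$ be a directive bi-sequence whose prefix of length $n$ is normalized. Suppose that the prefix of length $n+1$ of $(\Delta,\Theta)$ is none of the following, where $i,j,k$ are pairwise distinct letters and $l\ge 1$ (with $l\ge 2$ in (2)): 1. $(i^{l}, E_i^{l-1}E_k)$ 2. $(i(ji)^{l-1}j, E_i(E_kR)^{l-1}E_i)$ 3. $((ij)^{l}i, E_iE_k(RE_k)^{l-1}E_j)$ 4. $(ijj, E_iE_kE_i)$ 5. $(ijj, E_iE_kE_k)$ 6. $(ijk(jj)^{l-1}j, E_iE_kE_j(RE_j)^{l-1}E_k)$ 7. $(ijkj(jj)^{l-1}j, E_iE_kE_jR(E_jR)^{l-1}E_i)$ 8. $(ij, E_iR)$ 9. $(ij, E_iE_j)$ 10. $(ij(ij)^{l-1}i, E_iE_k(RE_k)^{l-1}E_i)$ 11. $(i(ji)^{l}j, E_i(E_kR)^{l}E_j)$ 12. $((ijk)^{l-1}ijk, (E_iE_kE_j)^{l-1}E_iE_kR)$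 13. $((ijk)^{l}ij, (E_iE_kE_j)^{l}E_iR)$ 14. $((ijk)^{l}i, (E_iE_kE_j)^{l}R)$ 15. $((ijk)^{l}jk, (E_iE_kE_j)^{l}RR)$ 16. $((ijk)^{l}ikk, (E_iE_kE_j)^{l}E_iRR)$ 17. $((ijk)^{l-1}ijik, (E_iE_kE_j)^{l-1}E_iE_kRR)$ 18. $(i(ji)^{l-1}jkj, E_i(E_kR)^{l-1}E_kE_jE_j)$ 19. $(ij(ij)^{l-1}ikk, E_iE_k(RE_k)^{l-1}RE_iE_k)$ 20. $(i^{l}jj, E_i^{l}E_kE_k)$ 21. $(ij(ij)^{l}kk, E_iE_k(RE_k)^{l}E_iE_i)$ 22. $(i^{l}jj, E_i^{l}E_kE_i)$ 23. $(ij(ij)^{l-1}ikj, E_iE_k(RE_k)^{l-1}RE_jE_k)$ 24. $(ijk(jj)^{l-1}ik, E_iE_kE_j(RE_j)^{l-1}E_iE_i)$ 25. $(ijk(jj)^{l-1}jki, E_iE_kE_j(RE_j)^{l-1}RE_kE_j)$ 26. $(i^{l}ji, E_i^{l}E_kE_k)$ 27. $(i^{l}ijj, E_i^{l}E_iE_jE_j)$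 28. $(i^{l}ijk, E_i^{l}E_iE_iE_i)$ 29. $(ij, E_iE_i)$ 30. $(ijjk, E_iE_kE_jE_j)$ 31. $(ijk, E_iE_kE_k)$ 32. $(i(ji)^{l}kkj, E_i(E_kR)^{l}E_iE_jE_j)$ 33. $(i^{l}jjk, E_i^{l}E_kE_jE_j)$ 34. $(i(ji)^{l}kjk, E_i(E_kR)^{l}E_jE_iE_i)$ 35. $(ijk(jj)^{l-1}jkik, E_iE_kE_j(RE_j)^{l-1}RE_kE_iE_i)$ Then exactly two pseudopalindromic prefixes are missed between $w_n$ and $w_{n+1}$ if and only if $n\ge 3$ and $$(\delta_{n-2}\delta_{n-1}\delta_n\delta_{n+1},\ \vartheta_{n-2}\vartheta_{n-1}\vartheta_n\vartheta_{n+1})=(ab_1b_2b_3,\ E_iE_jE_kE_k)$$ for some letters $a,b_1,b_2,b_3$ and some pairwise distinct letters $i,j,k$ with $E_i(b_1)=E_j(b_2)=E_k(b_3)$. Moreover, this gives the factor rule $(ab_1b_2b_3, E_iE_jE_kE_k)\to(ab_1b_2b_3b_1b_2, E_iE_jE_kE_iE_jE_k)$: if these four last terms have the above form, let $(\Delta',\Theta')$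 be obtained from $(\Delta,\Theta)$ by replacing these four terms by the six terms $(ab_1b_2b_3b_1b_2, E_iE_jE_kE_iE_jE_k)$, and let $w'_m$ be the corresponding prefixes. Then $w'_{n+3}=w_{n+1}$, the prefix of length $n+3$ of $(\Delta',\Theta')$ is normalized, the prefixes missed between $w_n$ and $w_{n+1}$ are exactly $w'_{n+1}$ and $w'_{n+2}$, and $\mathbf u(\Delta',\Theta')=\mathbf u(\Delta,\Theta)$. -/

import Mathlib

namespace TernaryPseudo

/-- The letters `0, 1, 2` of the ternary alphabet. -/
abbrev Letter := Fin 3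

/-- The four involutory antimorphisms of the free monoid over the ternary alphabet. -/
inductive Anti where
  | R : Anti
  | E : Letter → Anti
  deriving DecidableEq

open Anti

/-- Letter images: `R` fixes every letter, `E i` fixes `i` and exchanges the two other letters. -/
def Anti.onLetter : Anti → Letter → Letter
  | R, x => x
  | E i, x => Equiv.swap (i + 1) (i + 2) x

/-- The antimorphism on words. -/
def Anti.onWord (t : Anti) (v : List Letter) : List Letter :=
  (v.map t.onLetter).reverse

theorem Anti.onLetter_onLetter (t : Anti) (x : Letter) : t.onLetter (t.onLetter x) = x := by
  cases t <;> simp [Anti.onLetter]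

theorem Anti.onWord_append (t : Anti) (u v : List Letter) :
    t.onWord (u ++ v) = t.onWord v ++ t.onWord u := by
  simp [Anti.onWord]

theorem Anti.onWord_onWord (t : Anti) (v : List Letter) : t.onWord (t.onWord v) = v := by
  have h : t.onLetter ∘ t.onLetter = id := funext fun x => t.onLetter_onLetter x
  simp [Anti.onWord, List.map_reverse, h]

theorem Anti.length_onWord (t : Anti) (v : List Letter) : (t.onWord v).length = v.length := by
  simp [Anti.onWord]

/-- `v` is a `t`-palindrome. -/
def IsPal (t : Anti) (v : List Letter) : Prop := t.onWord v = v

instance (t : Anti) (v : List Letter) : Decidable (IsPal t v) :=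
  inferInstanceAs (Decidable (t.onWord v = v))

/-- `v` is a pseudopalindrome. -/
def IsPseudopal (v : List Letter) : Prop := ∃ t : Anti, IsPal t v

theorem exists_isPal_drop (t : Anti) (v : List Letter) : ∃ s, IsPal t (v.drop s) :=
  ⟨v.length, by simp [IsPal, Anti.onWord]⟩

/-- The `t`-palindromic closure of `v`: writing `v = x y` with `y` the longest `t`-palindromic
suffix of `v`, it is `x y t(x)`. By `closure_isPal`, `prefix_closure` and `closure_shortest` it is
the shortest `t`-palindrome that has `v` as a prefix. -/
def closure (t : Anti) (v : List Letter) : List Letter :=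
  v ++ t.onWord (v.take (Nat.find (exists_isPal_drop t v)))

theorem prefix_closure (t : Anti) (v : List Letter) : v <+: closure t v :=
  List.prefix_append _ _

theorem closure_isPal (t : Anti) (v : List Letter) : IsPal t (closure t v) := by
  unfold closure
  have h := Nat.find_spec (exists_isPal_drop t v)
  set s := Nat.find (exists_isPal_drop t v)
  have hv : v = v.take s ++ v.drop s := (List.take_append_drop s v).symm
  unfold IsPal at h ⊢
  rw [Anti.onWord_append, Anti.onWord_onWord]
  conv_lhs => rw [hv]
  rw [Anti.onWord_append, h]
  rw [← List.append_assoc]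
  simp

theorem closure_shortest (t : Anti) (v x : List Letter) (hx : IsPal t x) (hv : v <+: x) :
    (closure t v).length ≤ x.length := by
  obtain ⟨y, rfl⟩ := hv
  by_contra hlt
  have hs := Nat.find_min (exists_isPal_drop t v) (m := y.length)
  unfold closure at hlt
  set s := Nat.find (exists_isPal_drop t v)
  simp only [List.length_append, Anti.length_onWord, List.length_take] at hlt
  have h1 : y.length < s := by omega
  have h2 : y.length ≤ v.length := by omega
  apply hs h1
  unfold IsPal at hx ⊢
  have hv : v = v.take y.length ++ v.drop y.length := (List.take_append_drop _ v).symm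
  have e1 : t.onWord y ++ t.onWord v = v ++ y := by rw [← Anti.onWord_append, hx]
  have e2 : t.onWord v = t.onWord (v.drop y.length) ++ t.onWord (v.take y.length) := by
    rw [← Anti.onWord_append, ← hv]
  have e3 : t.onWord y ++ (t.onWord (v.drop y.length) ++ t.onWord (v.take y.length))
      = v.take y.length ++ (v.drop y.length ++ y) := by
    rw [← e2, e1, ← List.append_assoc, ← hv]
  have e4 := (List.append_inj e3 (by simp [Anti.length_onWord, h2])).2
  exact (List.append_inj e4 (by simp [Anti.length_onWord])).1

/-- The prefixes `w_n` directed by the bi-sequence `(Δ, Θ)`: `w_0` is empty and `w_{n+1}` is the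
`ϑ_{n+1}`-palindromic closure of `w_n δ_{n+1}`. Streams are indexed from `0`, so `δ_{n+1}` is
`Δ.get n` and `ϑ_{n+1}` is `Θ.get n`. -/
def w (Δ : Stream' Letter) (Θ : Stream' Anti) : ℕ → List Letter
  | 0 => []
  | n + 1 => closure (Θ.get n) (w Δ Θ n ++ [Δ.get n])

theorem w_append_prefix (Δ : Stream' Letter) (Θ : Stream' Anti) (n : ℕ) :
    w Δ Θ n ++ [Δ.get n] <+: w Δ Θ (n + 1) :=
  prefix_closure _ _

theorem le_length_w (Δ : Stream' Letter) (Θ : Stream' Anti) (n : ℕ) :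
    n ≤ (w Δ Θ n).length := by
  induction n with
  | zero => simp
  | succ n ih =>
    have h := (w_append_prefix Δ Θ n).length_le
    simp only [List.length_append, List.length_singleton] at h
    omega

theorem w_prefix_w (Δ : Stream' Letter) (Θ : Stream' Anti) {m n : ℕ} (h : m ≤ n) :
    w Δ Θ m <+: w Δ Θ n := by
  induction n, h using Nat.le_induction with
  | base => exact List.prefix_rfl
  | succ n _ ih =>
    exact ih.trans ((List.prefix_append _ _).trans (w_append_prefix Δ Θ n))

/-- The infinite generalized pseudostandard word `u(Δ, Θ)`. -/
def word (Δ : Stream' Letter) (Θ : Stream' Anti) : Stream' Letter :=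
  fun m => (w Δ Θ (m + 1))[m]'(le_length_w Δ Θ (m + 1))

/-- Every `w_n` is a prefix of `u(Δ, Θ)`. -/
theorem take_word (Δ : Stream' Letter) (Θ : Stream' Anti) (n : ℕ) :
    (word Δ Θ).take (w Δ Θ n).length = w Δ Θ n := by
  apply List.ext_getElem
  · simp
  · intro m h1 h2
    rw [Stream'.take_get]
    change (w Δ Θ (m + 1))[m]'(le_length_w Δ Θ (m + 1)) = _
    rcases Nat.le_total (m + 1) n with h | h
    · exact (w_prefix_w Δ Θ h).getElem _
    · exact ((w_prefix_w Δ Θ h).getElem _).symm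

/-- The pseudopalindromic prefixes missed between `w_n` and `w_{n+1}`: the pseudopalindromic
prefixes whose length is strictly between `|w_n|` and `|w_{n+1}|`. -/
def missed (Δ : Stream' Letter) (Θ : Stream' Anti) (n : ℕ) : Set (List Letter) :=
  {p | IsPseudopal p ∧ p <+: w Δ Θ (n + 1) ∧
    (w Δ Θ n).length < p.length ∧ p.length < (w Δ Θ (n + 1)).length}

/-- The prefix of length `n` of `(Δ, Θ)` is normalized: every pseudopalindromic prefix of `w_n` is
one of `w_0, …, w_n`, and moreover, whenever `w_n` starts with `i^l`, the sequence of antimorphisms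
starts with `E_i^l`. -/
def NormalizedPrefix (Δ : Stream' Letter) (Θ : Stream' Anti) (n : ℕ) : Prop :=
  (∀ p : List Letter, p <+: w Δ Θ n → IsPseudopal p → ∃ m ≤ n, p = w Δ Θ m) ∧
  (∀ (i : Letter) (l : ℕ), l ≤ n → List.replicate l i <+: w Δ Θ n → ∀ m < l, Θ.get m = E i)

/-- The word `v^l`. -/
def rep {α : Type} (l : ℕ) (v : List α) : List α := (List.replicate l v).flatten

/-- The left-hand sides of the prefix rules. For fixed letters `i, j, k` (pairwise distinct where
this is used), `PrefixRule i j k D T` says that `(D, T)` is one of them. The parameter `l` here runs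
over all natural numbers; it is the usual exponent (which starts at `1`, or at `2` in the second
rule) shifted so as to start at `0`. -/
inductive PrefixRule (i j k : Letter) : List Letter → List Anti → Prop
  | r1 (l : ℕ) : PrefixRule i j k (rep (l + 1) [i]) (rep l [E i] ++ [E k])
  | r2 (l : ℕ) : PrefixRule i j k ([i] ++ rep (l + 1) [j, i] ++ [j])
      ([E i] ++ rep (l + 1) [E k, R] ++ [E i])
  | r3 (l : ℕ) : PrefixRule i j k (rep (l + 1) [i, j] ++ [i])
      ([E i, E k] ++ rep l [R, E k] ++ [E j])
  | r4 : PrefixRule i j k [i, j, j] [E i, E k, E i]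
  | r5 : PrefixRule i j k [i, j, j] [E i, E k, E k]
  | r6 (l : ℕ) : PrefixRule i j k ([i, j, k] ++ rep l [j, j] ++ [j])
      ([E i, E k, E j] ++ rep l [R, E j] ++ [E k])
  | r7 (l : ℕ) : PrefixRule i j k ([i, j, k, j] ++ rep l [j, j] ++ [j])
      ([E i, E k, E j, R] ++ rep l [E j, R] ++ [E i])
  | r8 : PrefixRule i j k [i, j] [E i, R]
  | r9 : PrefixRule i j k [i, j] [E i, E j]
  | r10 (l : ℕ) : PrefixRule i j k ([i, j] ++ rep l [i, j] ++ [i])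
      ([E i, E k] ++ rep l [R, E k] ++ [E i])
  | r11 (l : ℕ) : PrefixRule i j k ([i] ++ rep (l + 1) [j, i] ++ [j])
      ([E i] ++ rep (l + 1) [E k, R] ++ [E j])
  | r12 (l : ℕ) : PrefixRule i j k (rep l [i, j, k] ++ [i, j, k])
      (rep l [E i, E k, E j] ++ [E i, E k, R])
  | r13 (l : ℕ) : PrefixRule i j k (rep (l + 1) [i, j, k] ++ [i, j])
      (rep (l + 1) [E i, E k, E j] ++ [E i, R])
  | r14 (l : ℕ) : PrefixRule i j k (rep (l + 1) [i, j, k] ++ [i])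
      (rep (l + 1) [E i, E k, E j] ++ [R])
  | r15 (l : ℕ) : PrefixRule i j k (rep (l + 1) [i, j, k] ++ [j, k])
      (rep (l + 1) [E i, E k, E j] ++ [R, R])
  | r16 (l : ℕ) : PrefixRule i j k (rep (l + 1) [i, j, k] ++ [i, k, k])
      (rep (l + 1) [E i, E k, E j] ++ [E i, R, R])
  | r17 (l : ℕ) : PrefixRule i j k (rep l [i, j, k] ++ [i, j, i, k])
      (rep l [E i, E k, E j] ++ [E i, E k, R, R])
  | r18 (l : ℕ) : PrefixRule i j k ([i] ++ rep l [j, i] ++ [j, k, j])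
      ([E i] ++ rep l [E k, R] ++ [E k, E j, E j])
  | r19 (l : ℕ) : PrefixRule i j k ([i, j] ++ rep l [i, j] ++ [i, k, k])
      ([E i, E k] ++ rep l [R, E k] ++ [R, E i, E k])
  | r20 (l : ℕ) : PrefixRule i j k (rep (l + 1) [i] ++ [j, j])
      (rep (l + 1) [E i] ++ [E k, E k])
  | r21 (l : ℕ) : PrefixRule i j k ([i, j] ++ rep (l + 1) [i, j] ++ [k, k])
      ([E i, E k] ++ rep (l + 1) [R, E k] ++ [E i, E i])
  | r22 (l : ℕ) : PrefixRule i j k (rep (l + 1) [i] ++ [j, j])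
      (rep (l + 1) [E i] ++ [E k, E i])
  | r23 (l : ℕ) : PrefixRule i j k ([i, j] ++ rep l [i, j] ++ [i, k, j])
      ([E i, E k] ++ rep l [R, E k] ++ [R, E j, E k])
  | r24 (l : ℕ) : PrefixRule i j k ([i, j, k] ++ rep l [j, j] ++ [i, k])
      ([E i, E k, E j] ++ rep l [R, E j] ++ [E i, E i])
  | r25 (l : ℕ) : PrefixRule i j k ([i, j, k] ++ rep l [j, j] ++ [j, k, i])
      ([E i, E k, E j] ++ rep l [R, E j] ++ [R, E k, E j])
  | r26 (l : ℕ) : PrefixRule i j k (rep (l + 1) [i] ++ [j, i])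
      (rep (l + 1) [E i] ++ [E k, E k])
  | r27 (l : ℕ) : PrefixRule i j k (rep (l + 1) [i] ++ [i, j, j])
      (rep (l + 1) [E i] ++ [E i, E j, E j])
  | r28 (l : ℕ) : PrefixRule i j k (rep (l + 1) [i] ++ [i, j, k])
      (rep (l + 1) [E i] ++ [E i, E i, E i])
  | r29 : PrefixRule i j k [i, j] [E i, E i]
  | r30 : PrefixRule i j k [i, j, j, k] [E i, E k, E j, E j]
  | r31 : PrefixRule i j k [i, j, k] [E i, E k, E k]
  | r32 (l : ℕ) : PrefixRule i j k ([i] ++ rep (l + 1) [j, i] ++ [k, k, j])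
      ([E i] ++ rep (l + 1) [E k, R] ++ [E i, E j, E j])
  | r33 (l : ℕ) : PrefixRule i j k (rep (l + 1) [i] ++ [j, j, k])
      (rep (l + 1) [E i] ++ [E k, E j, E j])
  | r34 (l : ℕ) : PrefixRule i j k ([i] ++ rep (l + 1) [j, i] ++ [k, j, k])
      ([E i] ++ rep (l + 1) [E k, R] ++ [E j, E i, E i])
  | r35 (l : ℕ) : PrefixRule i j k ([i, j, k] ++ rep l [j, j] ++ [j, k, i, k])
      ([E i, E k, E j] ++ rep l [R, E j] ++ [R, E k, E i, E i])

/-- The last four terms of the prefix of length `N` of `(Δ, Θ)` are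
`(a b₁ b₂ b₃, E_i E_j E_k E_k)` with `i, j, k` pairwise distinct and
`E_i(b₁) = E_j(b₂) = E_k(b₃)`. -/
def EndsInForm (Δ : Stream' Letter) (Θ : Stream' Anti) (N : ℕ)
    (i j k a b₁ b₂ b₃ : Letter) : Prop :=
  (i ≠ j ∧ i ≠ k ∧ j ≠ k) ∧
  [a, b₁, b₂, b₃] <:+ Δ.take N ∧ [E i, E j, E k, E k] <:+ Θ.take N ∧
  (E i).onLetter b₁ = (E j).onLetter b₂ ∧ (E j).onLetter b₂ = (E k).onLetter b₃

/-- The sequence `s` in which the four terms at (zero-based) positions `p, …, p + 3` have been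
replaced by the list `v`. -/
def replaceFour {α : Type} (s : Stream' α) (p : ℕ) (v : List α) : Stream' α :=
  (s.take p ++ v) ++ₛ s.drop (p + 4)

end TernaryPseudo

/-! ### Pseudopalindromic prefixes by length, and closure as minimality of length -/

namespace TernaryPseudo
open Anti

/-! Pseudopalindromic prefixes are studied through their lengths. If the prefixes of lengths `N` and
`N + d` are a τ- and a σ-palindrome, then shifting by `d` acts on the first `N` letters as the
permutation στ (the twist), and for `d ≤ N` reflection gives a pseudopalindromic prefix of length `N
- d`. Hence the gaps between consecutive lengths do not decrease (`gap_le`). Moreover three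
consecutive lengths are equally spaced as soon as the second gap is less than the first length
(`gap_eq`): the two twists then commute at one letter, hence everywhere, since commutators in S₃ are
even, and unequal gaps would give one more prefix, at the difference of the gaps.

Suppose that two prefixes are missed. Since |w_{n+1}| ≤ 2|w_n| + 2, the three gaps above |w_n| have
a common value d and the types run through E_k, E_i, E_j, E_k (`exists_chain`), one tiny case
excepted. Reflection at w_n gives an E_j-palindrome of length |w_n| - d and, if 2d ≤ |w_n|, an
E_i-palindrome of length |w_n| - 2d. If these are w_{n-1} and w_{n-2} with n ≥ 3, the last four
terms have the required form (`Chain.endsInForm`). Otherwise 3d ≤ |w_n| + 2 leaves only short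
configurations whose letters can be listed; each is contradictory or is one of the rules `r31` to
`r35`. The tiny case is `r29`.

Conversely, the form gives w_n δ_{n+1} the period d twisted by E_jE_i. This permutation has order 3,
so 3d is an ordinary period and |w_{n+1}| ≤ |w_n| + 3d; a shorter closure would contradict an
earlier closure or the normalization (`RegularEnd.exists_chain`). The twisted period then exhibits
the two missed prefixes, and `closure_take_eq` recognizes them as closures, which is the factor
rule. -/

instance : Fintype Anti where
  elems := {R, E 0, E 1, E 2}
  complete t := by
    rcases t with _ | i
    · simp
    · fin_cases i <;> simp

/-- The prefix of length `N` of the infinite word `U` is a `t`-palindrome. -/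
def PalPrefix (U : ℕ → Letter) (t : Anti) (N : ℕ) : Prop :=
  ∀ a b, a + b + 1 = N → U a = t.onLetter (U b)

theorem PalPrefix.congr {U V : ℕ → Letter} {t : Anti} {N : ℕ} (h : PalPrefix U t N)
    (hUV : ∀ m < N, U m = V m) : PalPrefix V t N := fun a b hab => by
  rw [← hUV a (by omega), ← hUV b (by omega)]
  exact h a b hab

theorem isPal_iff (t : Anti) (v : List Letter) :
    IsPal t v ↔ PalPrefix (fun m => v.getD m 0) t v.length := by
  constructor
  · intro h a b hab
    have ha : a < v.length := by omega
    have hb : b < v.length := by omega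
    have h1 : (t.onWord v)[a]'(by rw [t.length_onWord]; exact ha) = v[a] := by
      congr 1
    have h2 : v.length - 1 - a = b := by omega
    simp only [Anti.onWord, List.getElem_reverse, List.getElem_map, List.length_map, h2] at h1
    simp [ha, hb, h1]
  · intro h
    apply List.ext_getElem
    · exact t.length_onWord v
    · intro a h1 h2
      have hb : v.length - 1 - a < v.length := by omega
      have := h a (v.length - 1 - a) (by omega)
      simp only [List.getD_eq_getElem _ _ h2, List.getD_eq_getElem _ _ hb] at this
      simp [Anti.onWord, this]

theorem isPal_take_iff (U : Stream' Letter) (t : Anti) (N : ℕ) :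
    IsPal t (U.take N) ↔ PalPrefix U.get t N := by
  rw [isPal_iff, Stream'.length_take]
  have key : ∀ m < N, (U.take N).getD m 0 = U.get m := fun m hm => by
    rw [List.getD_eq_getElem _ _ (by simpa using hm), Stream'.take_get]
  exact ⟨fun h => h.congr key, fun h => h.congr fun m hm => (key m hm).symm⟩

theorem length_closure (t : Anti) (v : List Letter) :
    (closure t v).length = v.length + Nat.find (exists_isPal_drop t v) := by
  have : Nat.find (exists_isPal_drop t v) ≤ v.length :=
    Nat.find_min' _ (by simp [IsPal, Anti.onWord])
  simp [closure, Anti.length_onWord, this]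

theorem length_closure_le_of_isPal_drop (t : Anti) (v : List Letter) (s : ℕ)
    (h : IsPal t (v.drop s)) : (closure t v).length ≤ v.length + s := by
  rw [length_closure]
  exact Nat.add_le_add_left (Nat.find_min' _ h) _

section Word

variable (Δ : Stream' Letter) (Θ : Stream' Anti)

/-- The length of `w_n`. -/
def len (n : ℕ) : ℕ := (w Δ Θ n).length

/-- The letter of index `m` of the word directed by `(Δ, Θ)`. -/
def letter (m : ℕ) : Letter := (word Δ Θ).get m

theorem take_len (n : ℕ) : (word Δ Θ).take (len Δ Θ n) = w Δ Θ n := take_word Δ Θ n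

theorem len_zero : len Δ Θ 0 = 0 := rfl

theorem len_lt_succ (n : ℕ) : len Δ Θ n < len Δ Θ (n + 1) := by
  have h := (w_append_prefix Δ Θ n).length_le
  simp only [List.length_append, List.length_singleton] at h
  exact h

theorem len_strictMono : StrictMono (len Δ Θ) := strictMono_nat_of_lt_succ (len_lt_succ Δ Θ)

theorem le_len (n : ℕ) : n ≤ len Δ Θ n := le_length_w Δ Θ n

theorem take_len_succ (n : ℕ) :
    (word Δ Θ).take (len Δ Θ n + 1) = w Δ Θ n ++ [Δ.get n] := by
  have h : w Δ Θ n ++ [Δ.get n] <+: (word Δ Θ).take (len Δ Θ (n + 1)) := by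
    rw [take_len]; exact w_append_prefix Δ Θ n
  rw [List.prefix_iff_eq_take] at h
  rw [h, Stream'.take_take]
  congr 1
  have := len_lt_succ Δ Θ n
  simp only [List.length_append, List.length_singleton]
  change len Δ Θ n + 1 = min (len Δ Θ (n + 1)) (len Δ Θ n + 1)
  omega

theorem letter_len (n : ℕ) : letter Δ Θ (len Δ Θ n) = Δ.get n := by
  have h := take_len_succ Δ Θ n
  rw [Stream'.take_succ', take_len] at h
  exact List.singleton_injective (List.append_cancel_left h)

theorem isPal_take_word_iff (t : Anti) (N : ℕ) :
    IsPal t ((word Δ Θ).take N) ↔ PalPrefix (letter Δ Θ) t N := isPal_take_iff _ t N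

theorem palPrefix_len_succ (n : ℕ) : PalPrefix (letter Δ Θ) (Θ.get n) (len Δ Θ (n + 1)) := by
  rw [← isPal_take_word_iff, take_len]
  exact closure_isPal _ _

theorem eq_take_of_prefix {p : List Letter} {n : ℕ} (h : p <+: w Δ Θ n) :
    p = (word Δ Θ).take p.length := by
  have h' := h.length_le
  rw [← take_len, List.prefix_iff_eq_take, Stream'.take_take] at h
  conv_lhs => rw [h]
  congr 1
  change _ ≤ len Δ Θ n at h'
  omega

theorem take_prefix_w {N n : ℕ} (h : N ≤ len Δ Θ n) : (word Δ Θ).take N <+: w Δ Θ n := by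
  rw [← take_len]
  exact Stream'.take_prefix_take_left _ _ _ h

/-- A `ϑ`-palindromic suffix of `w_n δ_{n+1}` bounds the length of `w_{n+1}` from above. -/
theorem len_succ_le {n s : ℕ} (h : ∀ a b, s ≤ a → s ≤ b → a + b = s + len Δ Θ n →
      letter Δ Θ a = (Θ.get n).onLetter (letter Δ Θ b)) :
    len Δ Θ (n + 1) ≤ len Δ Θ n + 1 + s := by
  have h1 : IsPal (Θ.get n) ((w Δ Θ n ++ [Δ.get n]).drop s) := by
    rw [isPal_iff, ← take_len_succ]
    intro a b hab
    simp only [List.length_drop, Stream'.length_take] at hab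
    have key : ∀ m, m + s < len Δ Θ n + 1 →
        (((word Δ Θ).take (len Δ Θ n + 1)).drop s).getD m 0 = letter Δ Θ (s + m) := fun m hm => by
      rw [List.getD_eq_getElem _ _ (by simp; omega), List.getElem_drop, Stream'.take_get]
      rfl
    simp only [key a (by omega), key b (by omega)]
    exact h _ _ (by omega) (by omega) (by omega)
  have h2 := length_closure_le_of_isPal_drop _ _ _ h1
  rw [List.length_append] at h2
  exact h2

/-- Minimality of the closure: a missed prefix never has the type ϑ_{n+1}. This is what makes the
types in a chain differ from the last one. -/
theorem not_palPrefix_of_lt {n N : ℕ} (h1 : len Δ Θ n < N) (h2 : N < len Δ Θ (n + 1)) :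
    ¬ PalPrefix (letter Δ Θ) (Θ.get n) N := fun h => by
  rw [← isPal_take_word_iff] at h
  have h3 := closure_shortest (Θ.get n) (w Δ Θ n ++ [Δ.get n]) _ h (by
    rw [← take_len_succ]
    exact Stream'.take_prefix_take_left _ _ _ h1)
  rw [Stream'.length_take] at h3
  exact absurd (lt_of_lt_of_le h2 h3) (lt_irrefl _)

theorem mem_missed_iff {n : ℕ} {p : List Letter} :
    p ∈ missed Δ Θ n ↔ ∃ N, len Δ Θ n < N ∧ N < len Δ Θ (n + 1) ∧
      (∃ t, PalPrefix (letter Δ Θ) t N) ∧ p = (word Δ Θ).take N := by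
  constructor
  · rintro ⟨⟨t, ht⟩, h1, h2, h3⟩
    have hp := eq_take_of_prefix Δ Θ h1
    refine ⟨p.length, h2, h3, ⟨t, ?_⟩, hp⟩
    rwa [← isPal_take_word_iff, ← hp]
  · rintro ⟨N, h1, h2, ⟨t, ht⟩, rfl⟩
    refine ⟨⟨t, (isPal_take_word_iff Δ Θ t N).2 ht⟩, take_prefix_w Δ Θ h2.le, ?_, ?_⟩
    · rwa [Stream'.length_take]
    · rwa [Stream'.length_take]

variable {Δ Θ}

theorem NormalizedPrefix.exists_len_eq {n : ℕ} (h : NormalizedPrefix Δ Θ n) {N : ℕ} {t : Anti}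
    (hN : N ≤ len Δ Θ n) (ht : PalPrefix (letter Δ Θ) t N) : ∃ m ≤ n, N = len Δ Θ m := by
  obtain ⟨m, hm, e⟩ := h.1 _ (take_prefix_w Δ Θ hN) ⟨t, (isPal_take_word_iff Δ Θ t N).2 ht⟩
  exact ⟨m, hm, by rw [len, ← e, Stream'.length_take]⟩

theorem NormalizedPrefix.not_palPrefix {n m N : ℕ} (h : NormalizedPrefix Δ Θ n) (hm : m < n)
    (h1 : len Δ Θ m < N) (h2 : N < len Δ Θ (m + 1)) (t : Anti) :
    ¬ PalPrefix (letter Δ Θ) t N := fun ht => by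
  have hmono := len_strictMono Δ Θ
  obtain ⟨m', -, rfl⟩ := h.exists_len_eq (h2.le.trans (hmono.monotone hm)) ht
  rw [hmono.lt_iff_lt] at h1 h2
  omega

theorem onLetter_eq_of_ne : ∀ (s t : Anti) (a b : Letter), a ≠ b → s.onLetter a = t.onLetter a →
    s.onLetter b = t.onLetter b → s = t := by decide

theorem eq_of_onLetter_self : ∀ i a : Letter, (E i).onLetter a = a → i = a := by decide

theorem NormalizedPrefix.replicate {n l : ℕ} {i : Letter} (h : NormalizedPrefix Δ Θ n)
    (hl : l ≤ n) (hi : ∀ m < l, letter Δ Θ m = i) : ∀ m < l, Θ.get m = E i := by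
  refine h.2 i l hl ?_
  have : List.replicate l i = (word Δ Θ).take l := by
    apply List.ext_getElem (by simp)
    intro m h1 h2
    rw [Stream'.take_get, List.getElem_replicate]
    exact (hi m (by simpa using h1)).symm
  rw [this]
  exact take_prefix_w Δ Θ (hl.trans (le_len Δ Θ n))

/-- A nonempty `E_i`-palindrome `w_{m+1}` is directed by `E_i`. -/
theorem NormalizedPrefix.get_eq_E {n m : ℕ} {i : Letter} (h : NormalizedPrefix Δ Θ n) (hm : m < n)
    (hi : PalPrefix (letter Δ Θ) (E i) (len Δ Θ (m + 1))) : Θ.get m = E i := by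
  have h0 := palPrefix_len_succ Δ Θ m
  have hle := le_len Δ Θ (m + 1)
  by_cases hc : ∃ a < len Δ Θ (m + 1), letter Δ Θ a ≠ letter Δ Θ 0
  · obtain ⟨a, ha, hne⟩ := hc
    refine onLetter_eq_of_ne _ _ _ _ hne ?_ ?_
    · rw [← h0 (len Δ Θ (m + 1) - 1 - a) a (by omega), ← hi (len Δ Θ (m + 1) - 1 - a) a (by omega)]
    · rw [← h0 (len Δ Θ (m + 1) - 1) 0 (by omega), ← hi (len Δ Θ (m + 1) - 1) 0 (by omega)]
  -- A constant word is a palindrome for several types; only the second clause of normalization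
  -- singles out `E i`.
  · push Not at hc
    have h1 : i = letter Δ Θ 0 := by
      apply eq_of_onLetter_self
      rw [← hi (len Δ Θ (m + 1) - 1) 0 (by omega), hc _ (by omega)]
    exact h.replicate (l := m + 1) hm (fun a ha => (hc a (by omega)).trans h1.symm) m (by omega)

/-- The type of a pseudopalindrome with two distinct letters is unique. -/
theorem get_eq_of_ne {m a b : ℕ} {t : Anti} (ht : PalPrefix (letter Δ Θ) t (len Δ Θ (m + 1)))
    (ha : a < len Δ Θ (m + 1)) (hb : b < len Δ Θ (m + 1))
    (hne : letter Δ Θ a ≠ letter Δ Θ b) : Θ.get m = t := by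
  have h0 := palPrefix_len_succ Δ Θ m
  refine onLetter_eq_of_ne _ _ _ _ hne ?_ ?_
  · rw [← h0 (len Δ Θ (m + 1) - 1 - a) a (by omega), ← ht (len Δ Θ (m + 1) - 1 - a) a (by omega)]
  · rw [← h0 (len Δ Θ (m + 1) - 1 - b) b (by omega), ← ht (len Δ Θ (m + 1) - 1 - b) b (by omega)]

end Word

end TernaryPseudo

/-! ### Gaps between consecutive pseudopalindromic prefixes -/

namespace TernaryPseudo
open Anti

section Gaps

variable {U : ℕ → Letter} {τ σ r : Anti} {N d e : ℕ}

/-- Two nested pseudopalindromic prefixes give a period twisted by a permutation of letters. -/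
theorem PalPrefix.shift (hτ : PalPrefix U τ N) (hσ : PalPrefix U σ (N + d)) {m : ℕ} (hm : m < N) :
    U (m + d) = σ.onLetter (τ.onLetter (U m)) := by
  rw [hσ (m + d) (N - 1 - m) (by omega), hτ (N - 1 - m) m (by omega)]

theorem exists_conj : ∀ s t : Anti, ∃ r : Anti, ∀ x, r.onLetter x = t.onLetter (s.onLetter
    (t.onLetter x)) := by decide

/-- Reflection of a pseudopalindromic prefix at a shorter one. -/
theorem PalPrefix.reflect (hτ : PalPrefix U τ N) (hσ : PalPrefix U σ (N + d)) (hd : d ≤ N)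
    (hr : ∀ x, r.onLetter x = τ.onLetter (σ.onLetter (τ.onLetter x))) :
    PalPrefix U r (N - d) := fun a b hab => by
  rw [hτ a (b + d) (by omega), hτ.shift hσ (by omega), hr]

theorem PalPrefix.exists_reflect (hτ : PalPrefix U τ N) (hσ : PalPrefix U σ (N + d)) (hd : d ≤ N) :
    ∃ r, PalPrefix U r (N - d) := by
  obtain ⟨r, hr⟩ := exists_conj σ τ
  exact ⟨r, hτ.reflect hσ hd hr⟩

/-- A twisted period of a pseudopalindromic prefix gives a longer one. -/
theorem PalPrefix.extend (hτ : PalPrefix U τ N) (hd : d ≤ N) (ρ : Letter → Letter)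
    (hρ : ∀ m < N, U (m + d) = ρ (U m)) (hr : ∀ x, r.onLetter x = ρ (τ.onLetter x)) :
    PalPrefix U r (N + d) := by
  have key : ∀ a b, d ≤ a → a + b + 1 = N + d → U a = r.onLetter (U b) := fun a b ha hab => by
    obtain ⟨m, rfl⟩ := Nat.exists_eq_add_of_le' ha
    rw [hρ m (by omega), hτ m b (by omega), hr]
  intro a b hab
  rcases Nat.lt_or_ge a d with h | h
  · rw [key b a (by omega) (by omega), r.onLetter_onLetter]
  · exact key a b h hab

/-- If `e < d`, reflecting the longest prefix at the middle one lands at `N + d - e`, strictly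
inside the first gap. -/
theorem gap_le (hσ : PalPrefix U σ (N + d)) (hr : PalPrefix U r (N + d + e)) (he : 0 < e)
    (hno : ∀ M t, N < M → M < N + d → ¬ PalPrefix U t M) : d ≤ e := by
  by_contra h
  obtain ⟨s, hs⟩ := hσ.exists_reflect hr (by omega)
  exact hno _ s (by omega) (by omega) hs

/-- The hypothesis says that the twists στ and rσ commute at `a`. Their commutator is an even
permutation of three letters with a fixed point, hence the identity. The antimorphism `q` is the
type of the prefix built from the quotient of the twists. -/
theorem twist_comm : ∀ (τ σ r : Anti) (a : Letter),
    σ.onLetter (τ.onLetter (r.onLetter (σ.onLetter a))) = r.onLetter (τ.onLetter a) →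
    (∀ x, σ.onLetter (τ.onLetter (r.onLetter (σ.onLetter x))) = r.onLetter (τ.onLetter x)) ∧
    ∃ q : Anti, ∀ x, q.onLetter x = r.onLetter (σ.onLetter (τ.onLetter (σ.onLetter
      (σ.onLetter x)))) := by decide

/-- Three consecutive pseudopalindromic prefixes whose twists commute are equally spaced. -/
theorem gap_eq_of_comm (hτ : PalPrefix U τ N) (hσ : PalPrefix U σ (N + d))
    (hr : PalPrefix U r (N + d + e)) (hd : 0 < d) (he0 : 0 < e) (he : e ≤ N)
    (hno1 : ∀ M t, N < M → M < N + d → ¬ PalPrefix U t M)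
    (hno2 : ∀ M t, N + d < M → M < N + d + e → ¬ PalPrefix U t M) {a : Letter}
    (hc : σ.onLetter (τ.onLetter (r.onLetter (σ.onLetter a))) = r.onLetter (τ.onLetter a)) :
    e = d := by
  refine le_antisymm ?_ (gap_le hσ hr he0 hno1)
  by_contra hlt
  obtain ⟨hcomm, q, hq⟩ := twist_comm τ σ r a hc
  obtain ⟨f, rfl⟩ : ∃ f, e = f + d := ⟨e - d, by omega⟩
  refine hno2 (N + d + f) q (by omega) (by omega) (hσ.extend (by omega)
    (fun x => r.onLetter (σ.onLetter (τ.onLetter (σ.onLetter x)))) ?_ hq)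
  intro m hm
  -- For `m ≥ d` one goes back by `d` and forward by `e`. For `m < d` the forward shift must come
  -- first, which composes the twists in the other order; commutation and `e ≤ N` are needed here.
  rcases Nat.lt_or_ge m d with h | h
  · have h1 := hτ.shift hσ (m := m + f) (by omega)
    have h2 := hσ.shift hr hm
    rw [add_assoc, h2] at h1
    have h3 := hcomm (τ.onLetter (σ.onLetter (U m)))
    rw [τ.onLetter_onLetter, h1] at h3
    simpa [Anti.onLetter_onLetter] using (congrArg (fun x => τ.onLetter (σ.onLetter x)) h3).symm
  · obtain ⟨m, rfl⟩ := Nat.exists_eq_add_of_le' h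
    have h1 := hσ.shift hr (m := m) (by omega)
    have h2 := hτ.shift hσ (m := m) (by omega)
    rw [show m + d + f = m + (f + d) by omega, h1, h2]
    simp only [Anti.onLetter_onLetter]

/-- As `e < N`, the letter of index `d + e` can be reached from index 0 by the two shifts in either
order; comparing the results gives commutation at `U 0`. -/
theorem gap_eq (hτ : PalPrefix U τ N) (hσ : PalPrefix U σ (N + d))
    (hr : PalPrefix U r (N + d + e)) (hd : 0 < d) (he0 : 0 < e) (he : e < N)
    (hno1 : ∀ M t, N < M → M < N + d → ¬ PalPrefix U t M)
    (hno2 : ∀ M t, N + d < M → M < N + d + e → ¬ PalPrefix U t M) : e = d := by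
  refine gap_eq_of_comm (a := U 0) hτ hσ hr hd he0 he.le hno1 hno2 ?_
  have h1 := hτ.shift hσ (m := 0 + e) (by omega)
  have h2 := hσ.shift hr (m := 0 + d) (by omega)
  rw [hσ.shift hr (by omega)] at h1
  rw [hτ.shift hσ (by omega), add_right_comm, h1] at h2
  simpa only [Anti.onLetter_onLetter] using h2

/-- Agreement at two letters is equality of permutations, so στ = rσ = ϑr = ρ. As ϑ ≠ r, ρ is not
the identity; as ϑ ≠ σ, it is not a transposition. So ρ is a 3-cycle, no type is `R`, and ϑ = ρ³τ =
τ. -/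
theorem cyclic_of_twist : ∀ (τ σ r ϑ : Anti) (a b : Letter), a ≠ b → ϑ ≠ σ → ϑ ≠ r →
    σ.onLetter (τ.onLetter a) = r.onLetter (σ.onLetter a) →
    σ.onLetter (τ.onLetter b) = r.onLetter (σ.onLetter b) →
    r.onLetter (σ.onLetter a) = ϑ.onLetter (r.onLetter a) →
    r.onLetter (σ.onLetter b) = ϑ.onLetter (r.onLetter b) →
    ∃ i j k : Letter, i ≠ j ∧ i ≠ k ∧ j ≠ k ∧ τ = E k ∧ σ = E i ∧ r = E j ∧ ϑ = E k := by
  decide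

end Gaps

end TernaryPseudo

/-! ### Two missed prefixes form an equally spaced chain -/

namespace TernaryPseudo
open Anti

variable {Δ : Stream' Letter} {Θ : Stream' Anti} {n d : ℕ} {i j k : Letter}

/-- The situation in which two equally spaced pseudopalindromic prefixes, of types `E_i` and `E_j`,
are missed between the `E_k`-palindromes `w_n` and `w_{n+1}`. -/
structure Chain (Δ : Stream' Letter) (Θ : Stream' Anti) (n d : ℕ) (i j k : Letter) : Prop where
  ij : i ≠ j
  ik : i ≠ k
  jk : j ≠ k
  d_pos : 0 < d
  d_lt : d < len Δ Θ n
  n_pos : 0 < n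
  get_pred : Θ.get (n - 1) = E k
  get_self : Θ.get n = E k
  pal₀ : PalPrefix (letter Δ Θ) (E k) (len Δ Θ n)
  pal₁ : PalPrefix (letter Δ Θ) (E i) (len Δ Θ n + d)
  pal₂ : PalPrefix (letter Δ Θ) (E j) (len Δ Θ n + d + d)
  pal₃ : PalPrefix (letter Δ Θ) (E k) (len Δ Θ n + d + d + d)
  len_succ : len Δ Θ (n + 1) = len Δ Θ n + d + d + d
  bound : d + d + d ≤ len Δ Θ n + 2
  gap : ∀ M t, len Δ Θ n < M → M < len Δ Θ n + d → ¬ PalPrefix (letter Δ Θ) t M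

theorem len_succ_le_two_mul (n : ℕ) : len Δ Θ (n + 1) ≤ len Δ Θ n + len Δ Θ n + 2 := by
  have := len_succ_le Δ Θ (n := n) (s := len Δ Θ n + 1) (fun a b ha hb hab => by omega)
  omega

/-- The bound |w_{n+1}| ≤ 2|w_n| + 2 on the sum of three nondecreasing gaps lets `gap_eq` apply to
both triples. The left alternative is the only one in which the common gap is not smaller than
|w_n|. -/
theorem exists_chain {M₁ M₂ : ℕ} {t₁ t₂ : Anti} (h1 : len Δ Θ n < M₁) (h12 : M₁ < M₂)
    (h2 : M₂ < len Δ Θ (n + 1)) (ht₁ : PalPrefix (letter Δ Θ) t₁ M₁)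
    (ht₂ : PalPrefix (letter Δ Θ) t₂ M₂)
    (hall : ∀ M t, len Δ Θ n < M → M < len Δ Θ (n + 1) → PalPrefix (letter Δ Θ) t M →
      M = M₁ ∨ M = M₂) :
    (n = 1 ∧ len Δ Θ 1 = 1 ∧ len Δ Θ 2 = 4 ∧ PalPrefix (letter Δ Θ) t₂ 3) ∨ ∃ d i j k, Chain Δ Θ n d i j k := by
  have hT := len_succ_le_two_mul (Δ := Δ) (Θ := Θ) n
  have hn : n ≠ 0 := by
    rintro rfl
    rw [len_zero] at *
    omega
  obtain ⟨n, rfl⟩ : ∃ m, n = m + 1 := ⟨n - 1, by omega⟩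
  have hle := le_len Δ Θ (n + 1)
  have p0 := palPrefix_len_succ Δ Θ n
  have p3 := palPrefix_len_succ Δ Θ (n + 1)
  have hs := len_succ_le Δ Θ (n := n + 1) (s := 0)
  have hnl := @not_palPrefix_of_lt Δ Θ (n + 1)
  set U := letter Δ Θ
  set N := len Δ Θ (n + 1) with hN
  set T := len Δ Θ (n + 1 + 1) with hT'
  obtain ⟨d, rfl⟩ : ∃ d, M₁ = N + d := ⟨M₁ - N, by omega⟩
  obtain ⟨e, rfl⟩ : ∃ e, M₂ = N + d + e := ⟨M₂ - (N + d), by omega⟩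
  obtain ⟨f, hf⟩ : ∃ f, T = N + d + e + f := ⟨T - (N + d + e), by omega⟩
  rw [hf] at p3
  have no1 : ∀ M t, N < M → M < N + d → ¬ PalPrefix U t M := fun M t a b c => by
    have := hall M t a (by omega) c; omega
  have no2 : ∀ M t, N + d < M → M < N + d + e → ¬ PalPrefix U t M := fun M t a b c => by
    have := hall M t (by omega) (by omega) c; omega
  have no3 : ∀ M t, N + d + e < M → M < N + d + e + f → ¬ PalPrefix U t M := fun M t a b c => by
    have := hall M t (by omega) (by omega) c; omega
  have de := gap_le ht₁ ht₂ (by omega) no1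
  have ef := gap_le ht₂ p3 (by omega) no2
  obtain rfl : e = d := by
    by_contra hne
    exact hne (gap_eq p0 ht₁ ht₂ (by omega) (by omega) (by omega) no1 no2)
  obtain rfl : f = e := by
    by_contra hne
    exact hne (gap_eq ht₁ ht₂ p3 (by omega) (by omega) (by omega) no2 no3)
  rcases Nat.lt_or_ge f N with hfN | hfN
  swap
  · left
    have : n = 0 := by omega
    subst this
    exact ⟨rfl, show N = 1 by omega, show T = 4 by omega, by
      rwa [show 3 = N + f + f by omega]⟩
  right
  have s1 : ∀ m < N, U (m + f) = t₁.onLetter ((Θ.get n).onLetter (U m)) := fun m hm => p0.shift ht₁ hm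
  have s2 : ∀ m < N + f, U (m + f) = t₂.onLetter (t₁.onLetter (U m)) := fun m hm => ht₁.shift ht₂ hm
  have s3 : ∀ m < N + f + f, U (m + f) = (Θ.get (n + 1)).onLetter (t₂.onLetter (U m)) :=
    fun m hm => ht₂.shift p3 hm
  have hne1 : Θ.get (n + 1) ≠ t₁ := fun h => hnl h1 (by omega) (by rw [h]; exact ht₁)
  have hne2 : Θ.get (n + 1) ≠ t₂ := fun h => hnl (by omega) h2 (by rw [h]; exact ht₂)
  -- If w_n were constant, w_n δ_{n+1} would already be a palindrome of the right type, leaving no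
  -- room for missed prefixes.
  have hb : ∃ b < N, U b ≠ U 0 := by
    by_contra hcon
    push Not at hcon
    have e0 : U f = U 0 := hcon f hfN
    have f1 := s1 0 (by omega)
    have f2 := s2 0 (by omega)
    have f3 := s3 0 (by omega)
    rw [zero_add, e0] at f1 f2 f3
    have l1 : ∀ m < N + f, U m = U 0 := fun m hm => by
      rcases Nat.lt_or_ge m N with h | h
      · exact hcon m h
      · obtain ⟨m, rfl⟩ := Nat.exists_eq_add_of_le' (show f ≤ m by omega)
        rw [s1 m (by omega), hcon m (by omega), ← f1]
    have l2 : ∀ m < N + f + f, U m = U 0 := fun m hm => by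
      rcases Nat.lt_or_ge m (N + f) with h | h
      · exact l1 m h
      · obtain ⟨m, rfl⟩ := Nat.exists_eq_add_of_le' (show f ≤ m by omega)
        rw [s2 m (by omega), l1 m (by omega), ← f2]
    have l3 : U (N + f + f + f - 1) = U 0 := by
      rw [show N + f + f + f - 1 = N + f + f - 1 + f by omega, s3 _ (by omega), l2 _ (by omega), ← f3]
    have l4 := p3 (N + f + f + f - 1) 0 (by omega)
    rw [l3] at l4
    have := hs (fun a b _ _ hab => by rw [l1 a (by omega), l1 b (by omega), ← l4])
    omega
  obtain ⟨b, hbN, hb⟩ := hb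
  have u1 := s1 0 (by omega)
  have u2 := s2 0 (by omega)
  have u3 := s3 0 (by omega)
  have v1 := s1 b (by omega)
  have v2 := s2 b (by omega)
  have v3 := s3 b (by omega)
  obtain ⟨i, j, k, hij, hik, hjk, e0, rfl, rfl, e3⟩ := cyclic_of_twist (Θ.get n) t₁ t₂ (Θ.get (n + 1))
    (U 0) (U b) (Ne.symm hb) hne1 hne2 (by rw [← u1, ← u2]) (by rw [← v1, ← v2])
    (by rw [← u2, ← u3]) (by rw [← v2, ← v3])
  exact ⟨f, i, j, k, hij, hik, hjk, by omega, hfN, by omega, e0, e3, by rw [← e0]; exact p0, ht₁, ht₂,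
    by rw [← e3]; exact p3, hf, by omega, no1⟩

end TernaryPseudo

/-! ### Descending from a chain to the preceding prefixes -/

namespace TernaryPseudo
open Anti

variable {Δ : Stream' Letter} {Θ : Stream' Anti} {n d : ℕ} {i j k : Letter}

theorem exists_palPrefix_len (m : ℕ) : ∃ t, PalPrefix (letter Δ Θ) t (len Δ Θ m) := by
  cases m with
  | zero => exact ⟨R, fun a b hab => by rw [len_zero] at hab; omega⟩
  | succ m => exact ⟨_, palPrefix_len_succ Δ Θ m⟩

theorem twist_eq : ∀ i j k : Letter, i ≠ j → i ≠ k → j ≠ k → ∀ x,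
    (E i).onLetter ((E k).onLetter x) = (E j).onLetter ((E i).onLetter x) ∧
    (E k).onLetter ((E j).onLetter x) = (E j).onLetter ((E i).onLetter x) := by decide

theorem conj_eq : ∀ i j k : Letter, i ≠ j → i ≠ k → j ≠ k → ∀ x,
    (E i).onLetter x = (E j).onLetter ((E k).onLetter ((E j).onLetter x)) := by decide

theorem twist_values : ∀ i j k : Letter, i ≠ j → i ≠ k → j ≠ k →
    (E j).onLetter ((E i).onLetter i) = k ∧ (E j).onLetter ((E i).onLetter j) = i ∧
    (E j).onLetter ((E i).onLetter k) = j := by decide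

theorem swap_values : ∀ i j k : Letter, i ≠ j → i ≠ k → j ≠ k →
    (E i).onLetter i = i ∧ (E i).onLetter j = k ∧ (E i).onLetter k = j := by decide

namespace Chain

theorem shift (c : Chain Δ Θ n d i j k) {m : ℕ} (hm : m < len Δ Θ n + d + d) :
    letter Δ Θ (m + d) = (E j).onLetter ((E i).onLetter (letter Δ Θ m)) := by
  have h := twist_eq i j k c.ij c.ik c.jk (letter Δ Θ m)
  rw [c.pal₂.shift c.pal₃ hm, h.2]

theorem pal_sub (c : Chain Δ Θ n d i j k) : PalPrefix (letter Δ Θ) (E j) (len Δ Θ n - d) :=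
  c.pal₀.reflect c.pal₁ c.d_lt.le (conj_eq j k i c.jk c.ij.symm c.ik.symm)

theorem pal_sub_sub (c : Chain Δ Θ n d i j k) (h : d + d ≤ len Δ Θ n) :
    PalPrefix (letter Δ Θ) (E i) (len Δ Θ n - (d + d)) :=
  c.pal₀.reflect (by rw [← add_assoc]; exact c.pal₂) h (conj_eq i k j c.ik c.ij c.jk.symm)

/-- The reflected prefix of length |w_{p+1}| - d is some w_m. If it were shorter than w_p, the gap
below w_{p+1} would be less than the gap `d` above it, against `gap_eq`. -/
theorem len_pred {p : ℕ} (c : Chain Δ Θ (p + 1) d i j k) (hnorm : NormalizedPrefix Δ Θ (p + 1)) :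
    len Δ Θ p + d = len Δ Θ (p + 1) := by
  have hmono := len_strictMono Δ Θ
  have hd := c.d_lt
  have hd0 := c.d_pos
  have h3 := c.bound
  have hlt := len_lt_succ Δ Θ p
  obtain ⟨m, -, hm⟩ := hnorm.exists_len_eq (Nat.sub_le _ _) c.pal_sub
  have hmp : m ≤ p := Nat.lt_add_one_iff.1 (hmono.lt_iff_lt.1 (by omega))
  have := hmono.monotone hmp
  by_contra hne
  obtain ⟨t, ht⟩ := exists_palPrefix_len (Δ := Δ) (Θ := Θ) p
  obtain ⟨e, he⟩ : ∃ e, len Δ Θ (p + 1) = len Δ Θ p + e := ⟨_, (Nat.add_sub_of_le hlt.le).symm⟩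
  have h0 := c.pal₀
  have h1 := c.pal₁
  have hg := c.gap
  rw [he] at h0 h1 hg
  have := gap_eq ht h0 h1 (by omega) (by omega) (by omega)
    (fun M t h1 h2 => hnorm.not_palPrefix (Nat.lt_succ_self p) h1 (by omega) t) hg
  omega

/-- The argument of `len_pred` one step lower, where `gap_eq` may fail because w_p is short. At the
boundary |w_p| = d only type `R` escapes: if w_p has a type `E t`, both twists are even permutations
and commute, so `gap_eq_of_comm` applies. -/
theorem len_pred_pred {p : ℕ} (c : Chain Δ Θ (p + 2) d i j k)
    (hnorm : NormalizedPrefix Δ Θ (p + 2)) (h2d : d + d ≤ len Δ Θ (p + 2)) :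
    len Δ Θ p + d + d = len Δ Θ (p + 2) ∨
      len Δ Θ (p + 2) < len Δ Θ p + d + d ∧ len Δ Θ p ≤ d ∧
        (len Δ Θ p = d → PalPrefix (letter Δ Θ) R d) := by
  have hmono := len_strictMono Δ Θ
  have hd0 := c.d_pos
  have h1 : len Δ Θ (p + 1) + d = len Δ Θ (p + 2) := c.len_pred hnorm
  have hlt := len_lt_succ Δ Θ p
  obtain ⟨m, -, hm⟩ := hnorm.exists_len_eq (Nat.sub_le _ _) (c.pal_sub_sub h2d)
  have hmp : m ≤ p := Nat.lt_add_one_iff.1 (hmono.lt_iff_lt.1 (by omega))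
  have := hmono.monotone hmp
  by_cases hle : len Δ Θ p + d + d = len Δ Θ (p + 2)
  · exact Or.inl hle
  right
  obtain ⟨t, ht⟩ := exists_palPrefix_len (Δ := Δ) (Θ := Θ) p
  obtain ⟨e, he⟩ : ∃ e, len Δ Θ (p + 1) = len Δ Θ p + e := ⟨_, (Nat.add_sub_of_le hlt.le).symm⟩
  have p1 : PalPrefix (letter Δ Θ) (E j) (len Δ Θ p + e) := by
    rw [← he, show len Δ Θ (p + 1) = len Δ Θ (p + 2) - d by omega]
    exact c.pal_sub
  have p2 : PalPrefix (letter Δ Θ) (E k) (len Δ Θ p + e + d) := by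
    rw [← he, h1]
    exact c.pal₀
  have n1 : ∀ M t, len Δ Θ p < M → M < len Δ Θ p + e → ¬ PalPrefix (letter Δ Θ) t M :=
    fun M t a b => hnorm.not_palPrefix (m := p) (by omega) a (by omega) t
  have n2 : ∀ M t, len Δ Θ p + e < M → M < len Δ Θ p + e + d → ¬ PalPrefix (letter Δ Θ) t M :=
    fun M t a b => hnorm.not_palPrefix (m := p + 1) (by omega) (by omega)
      (by change M < len Δ Θ (p + 2); omega) t
  refine ⟨by omega, ?_, fun hpd => ?_⟩
  · by_contra hcon
    have := gap_eq ht p1 p2 (by omega) (by omega) (by omega) n1 n2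
    omega
  · rcases t with _ | t
    · rwa [← hpd]
    · have hc : ∀ t j k a : Letter, (E j).onLetter ((E t).onLetter ((E k).onLetter
          ((E j).onLetter a))) = (E k).onLetter ((E t).onLetter a) := by decide
      have := gap_eq_of_comm ht p1 p2 (by omega) (by omega) (by omega) n1 n2 (a := 0) (hc _ _ _ _)
      omega

theorem endsInForm {q : ℕ} (c : Chain Δ Θ (q + 3) d i j k) (hnorm : NormalizedPrefix Δ Θ (q + 3))
    (h : len Δ Θ (q + 1) + d + d = len Δ Θ (q + 3)) :
    EndsInForm Δ Θ (q + 4) i j k (Δ.get q) (Δ.get (q + 1)) (Δ.get (q + 2)) (Δ.get (q + 3)) := by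
  have h1 : len Δ Θ (q + 2) + d = len Δ Θ (q + 3) := c.len_pred hnorm
  have t0 : Θ.get q = E i := hnorm.get_eq_E (by omega) (by
    have := c.pal_sub_sub (by omega)
    rwa [← h, show len Δ Θ (q + 1) + d + d - (d + d) = len Δ Θ (q + 1) by omega] at this)
  have t1 : Θ.get (q + 1) = E j := hnorm.get_eq_E (by omega) (by
    have := c.pal_sub
    rwa [← h1, Nat.add_sub_cancel] at this)
  have t2 : Θ.get (q + 2) = E k := c.get_pred
  have hp := c.d_pos
  have s1 : Δ.get (q + 2) = (E j).onLetter ((E i).onLetter (Δ.get (q + 1))) := by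
    rw [← letter_len, ← letter_len, show len Δ Θ (q + 2) = len Δ Θ (q + 1) + d by omega]
    exact c.shift (by omega)
  have s2 : Δ.get (q + 3) = (E j).onLetter ((E i).onLetter (Δ.get (q + 2))) := by
    rw [← letter_len, ← letter_len, ← h1]
    exact c.shift (by omega)
  have hx : ∀ i j k : Letter, i ≠ j → i ≠ k → j ≠ k → ∀ x,
      (E j).onLetter x = (E k).onLetter ((E j).onLetter ((E i).onLetter x)) := by decide
  refine ⟨⟨c.ij, c.ik, c.jk⟩, ?_, ?_, ?_, ?_⟩
  · simp only [Stream'.take_succ', List.append_assoc, List.cons_append, List.nil_append]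
    exact List.suffix_append _ _
  · simp only [Stream'.take_succ', List.append_assoc, List.cons_append, List.nil_append, t0, t1, t2,
      c.get_self]
    exact List.suffix_append _ _
  · rw [s1, Anti.onLetter_onLetter]
  · rw [s2, ← hx i j k c.ij c.ik c.jk]

end Chain

end TernaryPseudo

/-! ### Directive bi-sequences of explicit periodic words -/

namespace TernaryPseudo
open Anti

section Rep

variable {α : Type} {s : Stream' α} {a b : α}

theorem rep_succ_right (l : ℕ) (v : List α) : rep (l + 1) v = rep l v ++ v := by
  simp [rep, List.replicate_succ']

theorem take_eq_rep (l : ℕ) (h : ∀ m < l, s.get m = a) : s.take l = rep l [a] := by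
  induction l with
  | zero => rfl
  | succ l ih =>
    rw [Stream'.take_succ', rep_succ_right, ih fun m hm => h m (by omega), h l (by omega)]

theorem take_add_two_mul (p l : ℕ)
    (h : ∀ t < l, s.get (p + 2 * t) = a ∧ s.get (p + 2 * t + 1) = b) :
    s.take (p + 2 * l) = s.take p ++ rep l [a, b] := by
  induction l with
  | zero => simp [rep]
  | succ l ih =>
    rw [show p + 2 * (l + 1) = p + 2 * l + 1 + 1 by omega, Stream'.take_succ', Stream'.take_succ',
      rep_succ_right, ih fun t ht => h t (by omega), (h l (by omega)).1, (h l (by omega)).2]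
    simp

end Rep

variable {Δ : Stream' Letter} {Θ : Stream' Anti} {n d p : ℕ} {i j k : Letter}

/-- If all prefixes of `w_p` are pseudopalindromes, then `w_m` has length `m` for `m ≤ p`. -/
theorem NormalizedPrefix.len_eq_self (h : NormalizedPrefix Δ Θ n) (hp : p ≤ n)
    (hall : ∀ M ≤ len Δ Θ p, ∃ t, PalPrefix (letter Δ Θ) t M) :
    ∀ m ≤ p, len Δ Θ m = m := by
  intro m hm
  induction m with
  | zero => rfl
  | succ m ih =>
    have ih := ih (by omega)
    have h1 := len_lt_succ Δ Θ m
    have h2 := (len_strictMono Δ Θ).monotone hm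
    by_contra hne
    obtain ⟨t, ht⟩ := hall (m + 1) (by omega)
    exact h.not_palPrefix (m := m) (by omega) (by omega) (by omega) t ht

theorem palPrefix_const {N : ℕ} (h : ∀ m < N, letter Δ Θ m = i) :
    ∀ M ≤ N, ∃ t, PalPrefix (letter Δ Θ) t M := fun M hM =>
  ⟨R, fun a b hab => by rw [h a (by omega), h b (by omega)]; rfl⟩

/-- The letters and types of a normalized word `a b a b ⋯ a`. -/
theorem NormalizedPrefix.take_of_alternating {r : ℕ} (h : NormalizedPrefix Δ Θ n) (hp : p ≤ n)
    (hij : i ≠ j) (hik : i ≠ k) (hjk : j ≠ k) (hr : 0 < r) (hlen : len Δ Θ p = 2 * r + 1)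
    (hU : ∀ m < 2 * r + 1, letter Δ Θ m = if m % 2 = 0 then i else j) :
    p = 2 * r + 1 ∧ Δ.take p = [i] ++ rep r [j, i] ∧ Θ.take p = [E i] ++ rep r [E k, R] := by
  have hE := swap_values k i j hik.symm hjk.symm hij
  have odd : ∀ s, 2 * s + 1 ≤ 2 * r + 1 → PalPrefix (letter Δ Θ) R (2 * s + 1) :=
    fun s hs a b hab => by
      rw [hU a (by omega), hU b (by omega), show a % 2 = b % 2 by omega]
      rfl
  have even : ∀ s, 2 * s ≤ 2 * r + 1 → PalPrefix (letter Δ Θ) (E k) (2 * s) :=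
    fun s hs a b hab => by
      rw [hU a (by omega), hU b (by omega)]
      rcases Nat.mod_two_eq_zero_or_one a with h | h
      · rw [h, show b % 2 = 1 by omega]
        exact hE.2.2.symm
      · rw [h, show b % 2 = 0 by omega]
        exact hE.2.1.symm
  -- Every prefix of the alternating word is a pseudopalindrome, so each closure adds exactly one
  -- letter.
  have hl := h.len_eq_self hp (fun M hM => by
    rcases Nat.even_or_odd' M with ⟨s, rfl | rfl⟩
    · exact ⟨_, even s (by omega)⟩
    · exact ⟨_, odd s (by omega)⟩)
  obtain rfl : p = 2 * r + 1 := by rw [← hlen, hl p le_rfl]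
  have hΔ : ∀ m < 2 * r + 1, Δ.get m = if m % 2 = 0 then i else j := fun m hm => by
    rw [← hU m hm, ← letter_len, hl m hm.le]
  have ne : letter Δ Θ 0 ≠ letter Δ Θ 1 := by
    rw [hU 0 (by omega), hU 1 (by omega)]
    simpa using hij
  refine ⟨rfl, ?_, ?_⟩
  · rw [add_comm, take_add_two_mul 1 r (a := j) (b := i), Stream'.take_succ', hΔ 0 (by omega)]
    · rfl
    · intro t ht
      rw [hΔ _ (by omega), hΔ _ (by omega), show (1 + 2 * t) % 2 = 1 by omega,
        show (1 + 2 * t + 1) % 2 = 0 by omega]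
      simp
  · rw [add_comm, take_add_two_mul 1 r (a := E k) (b := R), Stream'.take_succ',
      h.replicate (l := 1) (i := i) (by omega) _ 0 (by omega)]
    · rfl
    · intro m hm
      rw [hU m (by omega), show m = 0 by omega]
      rfl
    · intro t ht
      have l1 := hl (1 + 2 * t + 1) (by omega)
      have l2 := hl (1 + 2 * t + 1 + 1) (by omega)
      refine ⟨get_eq_of_ne (a := 0) (b := 1) ?_ (by omega) (by omega) ne,
        get_eq_of_ne (a := 0) (b := 1) ?_ (by omega) (by omega) ne⟩
      · rw [l1, show 1 + 2 * t + 1 = 2 * (t + 1) by omega]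
        exact even _ (by omega)
      · rw [l2, show 1 + 2 * t + 1 + 1 = 2 * (t + 1) + 1 by omega]
        exact odd _ (by omega)

/-- The letters and types of a normalized word `i j k j i j k j ⋯ i`. -/
theorem NormalizedPrefix.take_of_four_periodic {l : ℕ} (h : NormalizedPrefix Δ Θ n) (hp : p ≤ n)
    (hij : i ≠ j) (hik : i ≠ k) (hjk : j ≠ k) (hlen : len Δ Θ p = 4 * l + 5)
    (hU : ∀ m < 4 * l + 5, letter Δ Θ m = if m % 2 = 1 then j else if m % 4 = 0 then i else k) :
    p = 2 * l + 4 ∧ Δ.take p = [i, j, k] ++ rep l [j, j] ++ [j] ∧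
      Θ.take p = [E i, E k, E j] ++ rep l [R, E j] ++ [R] := by
  have hmono := len_strictMono Δ Θ
  have u0 : letter Δ Θ 0 = i := by rw [hU 0 (by omega)]; rfl
  have u1 : letter Δ Θ 1 = j := by rw [hU 1 (by omega)]; rfl
  have u2 : letter Δ Θ 2 = k := by rw [hU 2 (by omega)]; rfl
  have hEk := swap_values k i j hik.symm hjk.symm hij
  have hEj := swap_values j i k hij.symm hjk hik
  have ne01 : letter Δ Θ 0 ≠ letter Δ Θ 1 := by rw [u0, u1]; exact hij
  have e1 : ∀ s, 4 * s + 1 ≤ 4 * l + 5 → PalPrefix (letter Δ Θ) R (4 * s + 1) :=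
    fun s hs a b hab => by
      rw [hU a (by omega), hU b (by omega), show a % 2 = b % 2 by omega]
      by_cases hb : b % 2 = 1
      · simp [hb, Anti.onLetter]
      · rw [show a % 4 = b % 4 by omega]; rfl
  have e3 : ∀ s, 4 * s + 3 ≤ 4 * l + 5 → PalPrefix (letter Δ Θ) (E j) (4 * s + 3) :=
    fun s hs a b hab => by
      rw [hU a (by omega), hU b (by omega), show a % 2 = b % 2 by omega]
      by_cases hb : b % 2 = 1
      · simp [hb, hEj.1]
      · by_cases hb' : b % 4 = 0
        · simp [hb, hb', show a % 4 = 2 by omega, hEj.2.1]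
        · simp [hb, show b % 4 = 2 by omega, show a % 4 = 0 by omega, hEj.2.2]
  have e2 : PalPrefix (letter Δ Θ) (E k) 2 := by
    intro a b hab
    obtain ⟨rfl, rfl⟩ | ⟨rfl, rfl⟩ : a = 0 ∧ b = 1 ∨ a = 1 ∧ b = 0 := by omega
    · rw [u0, u1, hEk.2.2]
    · rw [u0, u1, hEk.2.1]
  -- Indices 0 and 2 carry distinct letters, but their mirror images are odd and both carry `j`.
  have even : ∀ s t, 2 * s + 4 ≤ 4 * l + 5 → ¬ PalPrefix (letter Δ Θ) t (2 * s + 4) := by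
    intro s t hs ht
    have h1 := ht 0 (2 * s + 3) (by omega)
    have h2 := ht 2 (2 * s + 1) (by omega)
    rw [hU (2 * s + 3) (by omega), if_pos (by omega), u0] at h1
    rw [hU (2 * s + 1) (by omega), if_pos (by omega), u2] at h2
    exact hik (h1.trans h2.symm)
  -- A normalized prefix misses nothing, so w_{m+1} is the next pseudopalindromic prefix. The
  -- lengths are therefore 1, 2, 3, 5, 7, ….
  have step : ∀ m, m < n → ∀ M t, len Δ Θ m < M → PalPrefix (letter Δ Θ) t M →
      (∀ L t, len Δ Θ m < L → L < M → ¬ PalPrefix (letter Δ Θ) t L) → len Δ Θ (m + 1) = M := by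
    intro m hm M t h1 ht hno
    have hlt := len_lt_succ Δ Θ m
    rcases lt_trichotomy (len Δ Θ (m + 1)) M with h2 | h2 | h2
    · exact absurd (palPrefix_len_succ Δ Θ m) (hno _ _ hlt h2)
    · exact h2
    · exact absurd ht (h.not_palPrefix hm h1 h2 t)
  have l1 : 0 < n → len Δ Θ 1 = 1 := fun h0 => step 0 h0 1 R (by rw [len_zero]; omega)
    (e1 0 (by omega)) (fun L t h1 h2 => by rw [len_zero] at h1; omega)
  have l2 : 1 < n → len Δ Θ 2 = 2 := fun h0 => step 1 h0 2 _ (by rw [l1 (by omega)]; omega)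
    e2 (fun L t h1 h2 => by rw [l1 (by omega)] at h1; omega)
  have l3 : ∀ s, s + 3 ≤ n → 2 * s + 3 ≤ 4 * l + 5 → len Δ Θ (s + 3) = 2 * s + 3 := by
    intro s
    induction s with
    | zero =>
      intro h0 _
      exact step 2 (by omega) 3 _ (by rw [l2 (by omega)]; omega) (e3 0 (by omega))
        (fun L t h1 h2 => by rw [l2 (by omega)] at h1; omega)
    | succ s ih =>
      intro h0 h1
      have ih := ih (by omega) (by omega)
      obtain ⟨t, ht⟩ : ∃ t, PalPrefix (letter Δ Θ) t (2 * (s + 1) + 3) := by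
        rcases Nat.even_or_odd' s with ⟨t, rfl | rfl⟩
        · exact ⟨R, by
            rw [show 2 * (2 * t + 1) + 3 = 4 * (t + 1) + 1 by omega]; exact e1 _ (by omega)⟩
        · exact ⟨E j, by
            rw [show 2 * (2 * t + 1 + 1) + 3 = 4 * (t + 1) + 3 by omega]; exact e3 _ (by omega)⟩
      rw [show s + 1 + 3 = s + 3 + 1 by omega]
      refine step (s + 3) (by omega) _ t (by omega) ht (fun L t h2 h3 => ?_)
      rw [show L = 2 * s + 4 by omega]
      exact even s t (by omega)
  obtain rfl : p = 2 * l + 4 := by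
    rcases Nat.lt_or_ge p (2 * l + 4) with hlt | hge
    · have := le_len Δ Θ p
      rcases Nat.lt_or_ge p 3 with h3 | h3
      · interval_cases p
        · rw [len_zero] at hlen; omega
        · rw [l1 (by omega)] at hlen; omega
        · rw [l2 (by omega)] at hlen; omega
      · obtain ⟨s, rfl⟩ := Nat.exists_eq_add_of_le' h3
        rw [l3 s hp (by omega)] at hlen
        omega
    · have := l3 (2 * l + 1) (by omega) (by omega)
      exact (hmono.injective (hlen.trans (by rw [this]; omega : _ = len Δ Θ (2 * l + 1 + 3))))
  refine ⟨rfl, ?_, ?_⟩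
  · rw [show 2 * l + 4 = 3 + 2 * l + 1 by omega, Stream'.take_succ',
      take_add_two_mul 3 l (a := j) (b := j)]
    · have a0 : Δ.get 0 = i := by rw [← letter_len Δ Θ, len_zero, u0]
      have a1 : Δ.get 1 = j := by rw [← letter_len Δ Θ, l1 (by omega), u1]
      have a2 : Δ.get 2 = k := by rw [← letter_len Δ Θ, l2 (by omega), u2]
      have a3 : Δ.get (3 + 2 * l) = j := by
        rw [← letter_len Δ Θ, add_comm, l3 (2 * l) (by omega) (by omega), hU _ (by omega),
          if_pos (by omega)]
      simp only [Stream'.take_succ', Stream'.take_zero, a0, a1, a2, a3]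
      rfl
    · intro t ht
      rw [← letter_len Δ Θ, ← letter_len Δ Θ, show 3 + 2 * t + 1 = (2 * t + 1) + 3 by omega,
        show 3 + 2 * t = 2 * t + 3 by omega, l3 _ (by omega) (by omega),
        l3 _ (by omega) (by omega), hU _ (by omega), hU _ (by omega), if_pos (by omega),
        if_pos (by omega)]
      exact ⟨rfl, rfl⟩
  · have ty : ∀ s t, s + 3 < 2 * l + 4 → PalPrefix (letter Δ Θ) t (2 * (s + 1) + 3) →
        Θ.get (s + 3) = t := fun s t hs ht => by
      have := l3 (s + 1) (by omega) (by omega)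
      rw [show s + 1 + 3 = s + 3 + 1 by omega] at this
      exact get_eq_of_ne (a := 0) (b := 1) (by rwa [this]) (by omega) (by omega) ne01
    have tR : ∀ t ≤ l, Θ.get (3 + 2 * t) = R := fun t ht => by
      rw [add_comm]
      apply ty _ _ (by omega)
      rw [show 2 * (2 * t + 1) + 3 = 4 * (t + 1) + 1 by omega]
      exact e1 _ (by omega)
    rw [show 2 * l + 4 = 3 + 2 * l + 1 by omega, Stream'.take_succ',
      take_add_two_mul 3 l (a := R) (b := E j), tR l le_rfl]
    · have a0 : Θ.get 0 = E i := h.replicate (l := 1) (by omega)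
        (fun m hm => by rw [show m = 0 by omega, u0]) 0 (by omega)
      have a1 : Θ.get 1 = E k := get_eq_of_ne (a := 0) (b := 1) (by rwa [l2 (by omega)])
        (by rw [l2 (by omega)]; omega) (by rw [l2 (by omega)]; omega) ne01
      have h3 : len Δ Θ (2 + 1) = 3 := l3 0 (by omega) (by omega)
      have a2 : Θ.get 2 = E j := get_eq_of_ne (a := 0) (b := 1)
        (by rw [h3]; exact e3 0 (by omega)) (by omega) (by omega) ne01
      simp only [Stream'.take_succ', Stream'.take_zero, a0, a1, a2]
      rfl
    · intro t ht
      refine ⟨tR t (by omega), ?_⟩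
      rw [show 3 + 2 * t + 1 = 2 * t + 1 + 3 by omega]
      apply ty _ _ (by omega)
      rw [show 2 * (2 * t + 1 + 1) + 3 = 4 * (t + 1) + 3 by omega]
      exact e3 _ (by omega)

end TernaryPseudo

/-! ### Irregular chains are excluded by the prefix rules -/

namespace TernaryPseudo
open Anti

variable {Δ : Stream' Letter} {Θ : Stream' Anti} {n d p : ℕ} {i j k : Letter}

namespace Chain

theorem take_types (c : Chain Δ Θ (p + 2) d i j k) (hnorm : NormalizedPrefix Δ Θ (p + 2)) :
    Θ.take (p + 3) = Θ.take p ++ [E j, E k, E k] := by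
  have h1 : len Δ Θ (p + 1) + d = len Δ Θ (p + 2) := c.len_pred hnorm
  have t1 : Θ.get p = E j := hnorm.get_eq_E (by omega) (by
    have := c.pal_sub
    rwa [← h1, Nat.add_sub_cancel] at this)
  have t2 : Θ.get (p + 1) = E k := c.get_pred
  simp only [Stream'.take_succ', t1, t2, c.get_self, List.append_assoc, List.cons_append,
    List.nil_append]

theorem take_letters (c : Chain Δ Θ (p + 2) d i j k) (hnorm : NormalizedPrefix Δ Θ (p + 2)) {m : ℕ}
    (hm : m + d + d = len Δ Θ (p + 2)) :
    Δ.take (p + 3) = Δ.take p ++ [letter Δ Θ (len Δ Θ p),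
      (E j).onLetter ((E i).onLetter (letter Δ Θ m)),
      (E j).onLetter ((E i).onLetter ((E j).onLetter ((E i).onLetter (letter Δ Θ m))))] := by
  have h1 : len Δ Θ (p + 1) + d = len Δ Θ (p + 2) := c.len_pred hnorm
  have hd := c.d_pos
  rw [← c.shift (m := m) (by omega), ← c.shift (m := m + d) (by omega), hm,
    show m + d = len Δ Θ (p + 1) by omega, letter_len, letter_len, letter_len]
  simp only [Stream'.take_succ', List.append_assoc, List.cons_append, List.nil_append]

end Chain

/-- No prefix rule applies to the prefix of length `N` of `(Δ, Θ)`. -/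
def NoPrefixRule (Δ : Stream' Letter) (Θ : Stream' Anti) (N : ℕ) : Prop :=
  ∀ i j k : Letter, i ≠ j → i ≠ k → j ≠ k → ¬ PrefixRule i j k (Δ.take N) (Θ.take N)

namespace Chain

theorem false_of_len_eq_two (c : Chain Δ Θ (p + 2) d i j k) (hnorm : NormalizedPrefix Δ Θ (p + 2))
    (hr : NoPrefixRule Δ Θ (p + 3)) (hd : d = 1) (hN : len Δ Θ (p + 2) = 2) : False := by
  subst hd
  have hp := le_len Δ Θ (p + 2)
  obtain rfl : p = 0 := by omega
  have h1 : len Δ Θ 1 + 1 = len Δ Θ 2 := c.len_pred hnorm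
  have hs := c.pal_sub
  rw [hN] at hs
  have u0 : letter Δ Θ 0 = j := (eq_of_onLetter_self _ _ (hs 0 0 rfl).symm).symm
  have hv := twist_values i j k c.ij c.ik c.jk
  refine hr j i k c.ij.symm c.jk c.ik ?_
  rw [c.take_types hnorm, c.take_letters hnorm (m := 0) (by rw [hN]), len_zero, u0, hv.2.1, hv.1]
  exact .r31

/-- Here |w_{p+2}| - 2d = d - 1, so an `E i`-palindrome of length `d - 1` sits in an `R`-palindrome
of length `d`. Period one twisted by `E i` makes w_p alternate between `j` and `k`: this is `r32`.
-/
theorem false_of_len_add_one (c : Chain Δ Θ (p + 2) d i j k) (hnorm : NormalizedPrefix Δ Θ (p + 2))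
    (hr : NoPrefixRule Δ Θ (p + 3)) (hd : 2 ≤ d) (hN : len Δ Θ (p + 2) + 1 = d + d + d)
    (hp : len Δ Θ p = d) (hR : PalPrefix (letter Δ Θ) R d) : False := by
  have hv := twist_values i j k c.ij c.ik c.jk
  have hE := swap_values i j k c.ij c.ik c.jk
  have hs := c.pal_sub
  have hss := c.pal_sub_sub (by omega)
  -- Middle letter of the `E j`-palindrome of length `2d - 1`.
  have ud : letter Δ Θ (d - 1) = j :=
    (eq_of_onLetter_self _ _ (hs (d - 1) (d - 1) (by omega)).symm).symm
  have u0 : letter Δ Θ 0 = j := (hR 0 (d - 1) (by omega)).trans ud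
  have st : ∀ m, m + 1 < d → letter Δ Θ (m + 1) = (E i).onLetter (letter Δ Θ m) := fun m hm => by
    have hR' : PalPrefix (letter Δ Θ) R (len Δ Θ (p + 2) - (d + d) + 1) := by
      rwa [show len Δ Θ (p + 2) - (d + d) + 1 = d by omega]
    exact hss.shift hR' (by omega)
  have hU : ∀ m < d, letter Δ Θ m = if m % 2 = 0 then j else k := by
    intro m
    induction m with
    | zero => intro _; exact u0
    | succ m ih =>
      intro hm
      rw [st m hm, ih (by omega)]
      rcases Nat.mod_two_eq_zero_or_one m with h | h
      · rw [h, show (m + 1) % 2 = 1 by omega]; exact hE.2.1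
      · rw [h, show (m + 1) % 2 = 0 by omega]; exact hE.2.2
  have hodd : (d - 1) % 2 = 0 := by
    by_contra hne
    have := hU (d - 1) (by omega)
    rw [if_neg hne, ud] at this
    exact c.jk this
  obtain ⟨l, rfl⟩ : ∃ l, d = 2 * (l + 1) + 1 := ⟨(d - 3) / 2, by omega⟩
  obtain ⟨-, hΔ, hΘ⟩ := hnorm.take_of_alternating (r := l + 1) (p := p) (by omega) c.jk c.ij.symm
    c.ik.symm (by omega) hp hU
  have up : letter Δ Θ (len Δ Θ p) = i := by
    have h := c.shift (m := 0) (by omega)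
    rwa [zero_add, u0, hv.2.1, ← hp] at h
  refine hr j k i c.jk c.ij.symm c.ik.symm ?_
  rw [c.take_types hnorm, c.take_letters hnorm (m := 2 * (l + 1) + 1 - 1) (by omega), up, ud, hv.2.1,
    hv.1, hΔ, hΘ]
  exact .r32 l

/-- In this case the closure attains the maximal length 2|w_{p+2}| + 2, so w_{p+2} δ_{p+3} has no
nonempty `E k`-palindromic suffix. The inequalities express this for suffixes of one and two
letters; the equality reads off the two middle letters of the `E j`-palindrome of length `2d - 2`.
-/
theorem letter_conditions (c : Chain Δ Θ (p + 2) d i j k) (hd : 2 ≤ d)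
    (hN : len Δ Θ (p + 2) + 2 = d + d + d) :
    letter Δ Θ (d - 1) = (E j).onLetter (letter Δ Θ (d - 2)) ∧
    (E j).onLetter ((E i).onLetter ((E j).onLetter ((E i).onLetter (letter Δ Θ (d - 2))))) ≠ k ∧
    (E j).onLetter ((E i).onLetter ((E j).onLetter ((E i).onLetter (letter Δ Θ (d - 2))))) ≠
      letter Δ Θ 0 := by
  have hE := swap_values k i j c.ik.symm c.jk.symm c.ij
  rw [← c.shift (by omega), ← c.shift (by omega), show d - 2 + d + d = len Δ Θ (p + 2) by omega]
  have ht : Θ.get (p + 2) = E k := c.get_self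
  refine ⟨c.pal_sub _ _ (by omega), fun hk => ?_, fun hk => ?_⟩
  · have := len_succ_le Δ Θ (n := p + 2) (s := len Δ Θ (p + 2)) (fun a b ha hb hab => by
      rw [show a = len Δ Θ (p + 2) by omega, show b = len Δ Θ (p + 2) by omega, ht, hk, hE.1])
    have := c.len_succ
    omega
  · have hlast := c.pal₀ (len Δ Θ (p + 2) - 1) 0 (by omega)
    have := len_succ_le Δ Θ (n := p + 2) (s := len Δ Θ (p + 2) - 1) (fun a b ha hb hab => by
      rw [ht]
      obtain ⟨h1, h2⟩ | ⟨h1, h2⟩ : a = len Δ Θ (p + 2) - 1 ∧ b = len Δ Θ (p + 2) ∨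
          a = len Δ Θ (p + 2) ∧ b = len Δ Θ (p + 2) - 1 := by omega
      · rw [h1, h2, hlast, hk]
      · rw [h1, h2, hlast, hk, Anti.onLetter_onLetter])
    have := c.len_succ
    omega

theorem false_of_const (c : Chain Δ Θ (p + 2) d i j k) (hnorm : NormalizedPrefix Δ Θ (p + 2))
    (hr : NoPrefixRule Δ Θ (p + 3)) (hd : 2 ≤ d) (hN : len Δ Θ (p + 2) + 2 = d + d + d)
    (hp : len Δ Θ p + 1 = d) (hU : ∀ m < d - 1, letter Δ Θ m = i) : False := by
  have hv := twist_values i j k c.ij c.ik c.jk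
  have hE := swap_values j i k c.ij.symm c.jk c.ik
  obtain ⟨h1, -, -⟩ := c.letter_conditions hd hN
  have hl := hnorm.len_eq_self (p := p) (by omega) (palPrefix_const (i := i) fun m hm =>
    hU m (by omega))
  have hlp := hl p le_rfl
  obtain ⟨l, rfl⟩ : ∃ l, p = l + 1 := ⟨p - 1, by omega⟩
  have hΔ : Δ.take (l + 1) = rep (l + 1) [i] := take_eq_rep _ fun m hm => by
    rw [← letter_len Δ Θ, hl m (by omega), hU m (by omega)]
  have hΘ : Θ.take (l + 1) = rep (l + 1) [E i] := take_eq_rep _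
    (hnorm.replicate (by omega) fun m hm => hU m (by omega))
  refine hr i k j c.ik c.ij c.jk.symm ?_
  rw [c.take_types hnorm, c.take_letters hnorm (m := d - 2) (by omega),
    show len Δ Θ (l + 1) = d - 1 by omega, h1, hU (d - 2) (by omega), hE.2.1, hv.1, hv.2.2, hΔ, hΘ]
  exact .r33 l

/-- For w_p of type `s` with first letter `a` and last letter `b`, whose letters advance by the
twist of `s` and `E i`: it is constant, or alternates, or the twist is trivial although the ends
differ, or the twist continues for one more letter and yields a pseudopalindrome of length |w_p| +
1. -/
theorem short_cases : ∀ i j k : Letter, i ≠ j → i ≠ k → j ≠ k → ∀ (s : Anti) (a b : Letter),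
    b = s.onLetter a → (E j).onLetter ((E i).onLetter ((E j).onLetter ((E i).onLetter b))) ≠ k →
    (E j).onLetter ((E i).onLetter ((E j).onLetter ((E i).onLetter b))) ≠ a →
    (s.onLetter ((E i).onLetter i) = i ∧ a = i) ∨ (s = R ∧ a = k ∧ b = k) ∨ (s = E i ∧ a ≠ b) ∨
    ((E j).onLetter b = s.onLetter ((E i).onLetter b) ∧
      ∃ q : Anti, ∀ x, q.onLetter x = s.onLetter ((E i).onLetter (s.onLetter x))) := by decide

theorem short_cases' : ∀ i j k : Letter, i ≠ j → i ≠ k → j ≠ k → ∀ b : Letter,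
    (E j).onLetter ((E i).onLetter ((E j).onLetter ((E i).onLetter b))) ≠ k →
    b = i ∧ (E j).onLetter b = k ∨ b = k ∧ (E j).onLetter b = i ∧
      (E j).onLetter ((E i).onLetter ((E j).onLetter ((E i).onLetter b))) = i := by decide

theorem false_of_len_succ_eq (c : Chain Δ Θ (p + 2) d i j k)
    (hnorm : NormalizedPrefix Δ Θ (p + 2))
    (hr : NoPrefixRule Δ Θ (p + 3)) (hd : 2 ≤ d) (hN : len Δ Θ (p + 2) + 2 = d + d + d)
    (hp : len Δ Θ p + 1 = d) : False := by
  have hv := twist_values i j k c.ij c.ik c.jk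
  have hE := swap_values i j k c.ij c.ik c.jk
  have hEj := swap_values j i k c.ij.symm c.jk c.ik
  obtain ⟨h1, h2, h3⟩ := c.letter_conditions hd hN
  have hgap : len Δ Θ (p + 1) + d = len Δ Θ (p + 2) := c.len_pred hnorm
  -- For `d = 2` the length `d` equals |w_{p+1}| = 2d - 2, so a pseudopalindrome of length `d` is no
  -- contradiction; length 3 is used instead.
  rcases Nat.lt_or_ge d 3 with hd3 | hd3
  · obtain rfl : d = 2 := by omega
    rcases short_cases' i j k c.ij c.ik c.jk _ h2 with ⟨hc, -⟩ | ⟨hc, hc', -⟩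
    · exact c.false_of_const hnorm hr hd hN hp fun m hm => by rw [show m = 2 - 2 by omega, hc]
    · rw [hc'] at h1
      have u2 := c.shift (m := 0) (by omega)
      rw [show letter Δ Θ 0 = k from hc, hv.2.2] at u2
      refine hnorm.not_palPrefix (m := p + 1) (N := 3) (by omega) (by omega)
        (by change 3 < len Δ Θ (p + 2); omega) (E i) fun a b hab => ?_
      obtain ⟨rfl, rfl⟩ | ⟨rfl, rfl⟩ | ⟨rfl, rfl⟩ :
        a = 0 ∧ b = 2 ∨ a = 1 ∧ b = 1 ∨ a = 2 ∧ b = 0 := by omega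
      · rw [show letter Δ Θ 0 = k from hc, show letter Δ Θ 2 = j from u2, hE.2.1]
      · rw [show letter Δ Θ 1 = i from h1, hE.1]
      · rw [show letter Δ Θ 0 = k from hc, show letter Δ Θ 2 = j from u2, hE.2.2]
  have hss := c.pal_sub_sub (by omega)
  rw [show len Δ Θ (p + 2) - (d + d) = d - 2 by omega] at hss
  obtain ⟨s, hs⟩ := exists_palPrefix_len (Δ := Δ) (Θ := Θ) p
  rw [show len Δ Θ p = d - 2 + 1 by omega] at hs
  have st : ∀ m < d - 2, letter Δ Θ (m + 1) = s.onLetter ((E i).onLetter (letter Δ Θ m)) :=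
    fun m hm => hss.shift hs hm
  rcases short_cases i j k c.ij c.ik c.jk s (letter Δ Θ 0) (letter Δ Θ (d - 2))
    (hs _ _ (by omega)) h2 h3 with ⟨a1, a2⟩ | ⟨rfl, a1, a2⟩ | ⟨rfl, a1⟩ |
      ⟨a1, q, hq⟩
  · refine c.false_of_const hnorm hr hd hN hp fun m => ?_
    induction m with
    | zero => intro _; exact a2
    | succ m ih =>
      intro hm
      rw [st m (by omega), ih (by omega), a1]
  · have hU : ∀ m < d - 1, letter Δ Θ m = if m % 2 = 0 then k else j := by
      intro m
      induction m with
      | zero => intro _; exact a1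
      | succ m ih =>
        intro hm
        rw [st m (by omega), ih (by omega)]
        rcases Nat.mod_two_eq_zero_or_one m with h | h
        · rw [h, show (m + 1) % 2 = 1 by omega]; exact hE.2.2
        · rw [h, show (m + 1) % 2 = 0 by omega]; exact hE.2.1
    have hev : (d - 2) % 2 = 0 := by
      by_contra hne
      have := hU (d - 2) (by omega)
      rw [if_neg hne, a2] at this
      exact c.jk this.symm
    obtain ⟨l, rfl⟩ : ∃ l, d = 2 * (l + 1) + 2 := ⟨(d - 4) / 2, by omega⟩
    obtain ⟨-, hΔ, hΘ⟩ := hnorm.take_of_alternating (r := l + 1) (p := p) (by omega) c.jk.symm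
      c.ik.symm c.ij.symm (by omega) (by omega) (fun m hm => hU m (by omega))
    refine hr k j i c.jk.symm c.ik.symm c.ij.symm ?_
    rw [c.take_types hnorm, c.take_letters hnorm (m := 2 * (l + 1) + 2 - 2) (by omega),
      show len Δ Θ p = 2 * (l + 1) + 2 - 1 by omega, h1, a2, hEj.2.2, hv.2.2, hv.2.1, hΔ, hΘ]
    exact .r34 l
  · refine absurd ?_ a1
    have : ∀ m ≤ d - 2, letter Δ Θ 0 = letter Δ Θ m := by
      intro m
      induction m with
      | zero => intro _; rfl
      | succ m ih => intro hm; rw [st m (by omega), Anti.onLetter_onLetter, ih (by omega)]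
    exact this _ le_rfl
  · refine hnorm.not_palPrefix (m := p) (N := d) (by omega) (by omega) (by omega) q ?_
    rw [show d = d - 2 + 1 + 1 by omega]
    refine hs.extend (by omega) (fun x => s.onLetter ((E i).onLetter x)) (fun m hm => ?_) hq
    rcases Nat.lt_or_ge m (d - 2) with h | h
    · exact st m h
    · rw [show m = d - 2 by omega, ← a1, ← h1, show d - 2 + 1 = d - 1 by omega]

/-- An `E i`-palindrome of length `d - 2` in an `R`-palindrome of length `d` gives period two
twisted by `E i`: odd indices carry `i`, even ones alternate between `k` and `j`. This is `r35`. -/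
theorem false_of_len_eq (c : Chain Δ Θ (p + 2) d i j k)
    (hnorm : NormalizedPrefix Δ Θ (p + 2))
    (hr : NoPrefixRule Δ Θ (p + 3)) (hd : 2 ≤ d) (hN : len Δ Θ (p + 2) + 2 = d + d + d)
    (hp : len Δ Θ p = d) (hR : PalPrefix (letter Δ Θ) R d) : False := by
  have hv := twist_values i j k c.ij c.ik c.jk
  have hE := swap_values i j k c.ij c.ik c.jk
  obtain ⟨h1, h2, h3⟩ := c.letter_conditions hd hN
  have hss := c.pal_sub_sub (by omega)
  rw [show len Δ Θ (p + 2) - (d + d) = d - 2 by omega] at hss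
  have hends : letter Δ Θ 0 = letter Δ Θ (d - 1) := hR 0 (d - 1) (by omega)
  rcases short_cases' i j k c.ij c.ik c.jk _ h2 with ⟨hc, hc'⟩ | ⟨hc, hc', hc''⟩
  swap
  · exact h3 (by rw [hc'', hends, h1, hc'])
  rw [h1, hc'] at hends
  have hd3 : 3 ≤ d := by
    by_contra hlt
    obtain rfl : d = 2 := by omega
    exact c.ik (hc.symm.trans hends)
  have u1 : letter Δ Θ 1 = i := (hR 1 (d - 2) (by omega)).trans hc
  have st : ∀ m, m + 2 < d → letter Δ Θ (m + 2) = (E i).onLetter (letter Δ Θ m) := fun m hm => by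
    have hR' : PalPrefix (letter Δ Θ) R (d - 2 + 2) := by rwa [show d - 2 + 2 = d by omega]
    exact hss.shift hR' (by omega)
  have hU : ∀ m < d, letter Δ Θ m = if m % 2 = 1 then i else if m % 4 = 0 then k else j := by
    intro m
    induction m using Nat.twoStepInduction with
    | zero => intro _; exact hends
    | one => intro _; exact u1
    | more m ih _ =>
      intro hm
      rw [st m hm, ih (by omega), show (m + 2) % 2 = m % 2 by omega]
      by_cases hm2 : m % 2 = 1
      · rw [if_pos hm2, if_pos hm2, hE.1]
      · by_cases hm4 : m % 4 = 0
        · rw [if_neg hm2, if_neg hm2, if_pos hm4, if_neg (by omega), hE.2.2]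
        · rw [if_neg hm2, if_neg hm2, if_neg hm4, if_pos (by omega), hE.2.1]
  have hmod : (d - 1) % 4 = 0 := by
    have := hU (d - 1) (by omega)
    rw [h1, hc'] at this
    by_contra hne
    split_ifs at this
    · exact c.ik this.symm
    · exact c.jk this.symm
  obtain ⟨l, rfl⟩ : ∃ l, d = 4 * l + 5 := ⟨(d - 5) / 4, by omega⟩
  obtain ⟨-, hΔ, hΘ⟩ := hnorm.take_of_four_periodic (l := l) (p := p) (by omega) c.ik.symm
    c.jk.symm c.ij hp hU
  have up : letter Δ Θ (len Δ Θ p) = j := by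
    have h := c.shift (m := 0) (by omega)
    rwa [zero_add, hends, hv.2.2, ← hp] at h
  refine hr k i j c.ik.symm c.jk.symm c.ij ?_
  rw [c.take_types hnorm, c.take_letters hnorm (m := 4 * l + 5 - 2) (by omega), up, hc, hv.1,
    hv.2.2, hΔ, hΘ]
  have h35 := PrefixRule.r35 (i := k) (j := i) (k := j) l
  simpa using h35

/-- Outside of the prefix rules, every chain is regular. -/
theorem exists_endsInForm (c : Chain Δ Θ n d i j k) (hnorm : NormalizedPrefix Δ Θ n)
    (hr : NoPrefixRule Δ Θ (n + 1)) :
    ∃ i j k a b₁ b₂ b₃ : Letter, EndsInForm Δ Θ (n + 1) i j k a b₁ b₂ b₃ := by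
  have hn := c.n_pos
  have hdN := c.d_lt
  have hd := c.d_pos
  have hN := c.bound
  have h1 : ∃ t, PalPrefix (letter Δ Θ) t 1 :=
    palPrefix_const (N := 1) (i := letter Δ Θ 0) (fun m hm => by rw [show m = 0 by omega]) 1 le_rfl
  obtain ⟨t, ht⟩ := h1
  obtain ⟨p, rfl⟩ : ∃ p, n = p + 2 := by
    rcases Nat.lt_or_ge n 2 with h | h
    · obtain rfl : n = 1 := by omega
      exact absurd ht (hnorm.not_palPrefix (m := 0) (by omega) (by rw [len_zero]; omega)
        (by change 1 < len Δ Θ 1; omega) t)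
    · exact ⟨n - 2, by omega⟩
  have hgap : len Δ Θ (p + 1) + d = len Δ Θ (p + 2) := c.len_pred hnorm
  rcases Nat.lt_or_ge (len Δ Θ (p + 2)) (d + d) with h2 | h2
  · exact (c.false_of_len_eq_two hnorm hr (by omega) (by omega)).elim
  have regular : len Δ Θ p + d + d = len Δ Θ (p + 2) → p ≠ 0 →
      ∃ i j k a b₁ b₂ b₃ : Letter, EndsInForm Δ Θ (p + 3) i j k a b₁ b₂ b₃ := fun h hp => by
    obtain ⟨q, rfl⟩ : ∃ q, p = q + 1 := ⟨p - 1, by omega⟩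
    exact ⟨_, _, _, _, _, _, _, c.endsInForm hnorm h⟩
  rcases c.len_pred_pred hnorm h2 with h | ⟨h, hle, hR⟩
  · by_cases hp : p = 0
    · subst hp
      rw [len_zero] at h
      rcases Nat.lt_or_ge 1 d with h3 | h3
      · exact absurd ht (hnorm.not_palPrefix (m := 0) (by omega) (by rw [len_zero]; omega)
          (by omega) t)
      · exact (c.false_of_len_eq_two hnorm hr (by omega) (by omega)).elim
    · exact regular h hp
  -- With |w_{p+2}| ≥ 3d - 2, the irregular case leaves |w_p| = d - 1 with |w_{p+2}| = 3d - 2, or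
  -- |w_p| = d with |w_{p+2}| equal to 3d - 2 or 3d - 1.
  · exfalso
    rcases Nat.lt_or_ge (len Δ Θ p) d with hlt | hge
    · exact c.false_of_len_succ_eq hnorm hr (by omega) (by omega) (by omega)
    · have hpd : len Δ Θ p = d := by omega
      rcases Nat.lt_or_ge (len Δ Θ (p + 2) + 1) (d + d + d) with h3 | h3
      · exact c.false_of_len_eq hnorm hr (by omega) (by omega) hpd (hR hpd)
      · by_cases hd2 : 2 ≤ d
        · exact c.false_of_len_add_one hnorm hr hd2 (by omega) hpd (hR hpd)
        · exact c.false_of_len_eq_two hnorm hr (by omega) (by omega)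

end Chain

/-- As |w_2| = 2|w_1| + 2, no nonempty suffix of w_1 δ_2 is a ϑ_2-palindrome. Together with the
pseudopalindrome of length 3 this forces ϑ_2 to fix the first letter and move the second: `r29`. -/
theorem false_of_len_one {t : Anti} (hnorm : NormalizedPrefix Δ Θ 1) (hr : NoPrefixRule Δ Θ 2)
    (h1 : len Δ Θ 1 = 1) (h2 : len Δ Θ 2 = 4) (ht : PalPrefix (letter Δ Θ) t 3) : False := by
  have p2 : PalPrefix (letter Δ Θ) (Θ.get 1) (len Δ Θ 2) := palPrefix_len_succ Δ Θ 1
  rw [h2] at p2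
  have c1 : letter Δ Θ 1 ≠ (Θ.get 1).onLetter (letter Δ Θ 1) := fun h => by
    have h3 : len Δ Θ 2 ≤ _ := len_succ_le Δ Θ (n := 1) (s := 1) (fun a b ha hb hab => by
      rw [show a = 1 by omega, show b = 1 by omega]; exact h)
    omega
  have c2 : letter Δ Θ 0 ≠ (Θ.get 1).onLetter (letter Δ Θ 1) := fun h => by
    have h3 : len Δ Θ 2 ≤ _ := len_succ_le Δ Θ (n := 1) (s := 0) (fun a b ha hb hab => by
      obtain ⟨rfl, rfl⟩ | ⟨rfl, rfl⟩ : a = 0 ∧ b = 1 ∨ a = 1 ∧ b = 0 := by omega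
      · exact h
      · rw [h, Anti.onLetter_onLetter])
    omega
  have u2 : letter Δ Θ 2 = (Θ.get 1).onLetter (letter Δ Θ 1) := p2 2 1 rfl
  have q1 := ht 1 1 rfl
  have q2 := ht 2 0 rfl
  have hne : letter Δ Θ 0 ≠ letter Δ Θ 1 := fun h => by
    rw [h, ← q1, u2] at q2
    exact c1 q2.symm
  have hE : ∀ (s : Anti) (a b : Letter), b ≠ s.onLetter b → a ≠ s.onLetter b → a ≠ b →
      s = E a := by decide
  have t0 : Θ.get 0 = E (letter Δ Θ 0) := hnorm.replicate (l := 1) le_rfl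
    (fun m hm => by rw [show m = 0 by omega]) 0 (by omega)
  have t1 := hE _ _ _ c1 c2 hne
  obtain ⟨k, hk1, hk2⟩ : ∃ k, letter Δ Θ 0 ≠ k ∧ letter Δ Θ 1 ≠ k := by
    generalize letter Δ Θ 0 = a
    generalize letter Δ Θ 1 = b
    revert a b
    decide
  refine hr _ _ k hne hk1 hk2 ?_
  have a0 : Δ.get 0 = letter Δ Θ 0 := (letter_len Δ Θ 0).symm
  have a1 : Δ.get 1 = letter Δ Θ 1 := by rw [← letter_len Δ Θ, h1]
  simp only [Stream'.take_succ', Stream'.take_zero, t0, t1, a0, a1]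
  exact .r29

theorem exists_endsInForm_of_ncard_eq_two (hnorm : NormalizedPrefix Δ Θ n)
    (hr : NoPrefixRule Δ Θ (n + 1)) (h : (missed Δ Θ n).ncard = 2) :
    ∃ i j k a b₁ b₂ b₃ : Letter, EndsInForm Δ Θ (n + 1) i j k a b₁ b₂ b₃ := by
  obtain ⟨x, y, hxy, hset⟩ := Set.ncard_eq_two.1 h
  obtain ⟨M₁, a1, a2, ⟨t₁, ht₁⟩, rfl⟩ := (mem_missed_iff Δ Θ).1 (hset ▸ Set.mem_insert x {y})
  obtain ⟨M₂, b1, b2, ⟨t₂, ht₂⟩, rfl⟩ := (mem_missed_iff Δ Θ).1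
    (hset ▸ Set.mem_insert_of_mem _ (Set.mem_singleton y) : y ∈ missed Δ Θ n)
  have hall : ∀ M t, len Δ Θ n < M → M < len Δ Θ (n + 1) → PalPrefix (letter Δ Θ) t M →
      M = M₁ ∨ M = M₂ := fun M t c1 c2 ht => by
    have hm : (word Δ Θ).take M ∈ missed Δ Θ n :=
      (mem_missed_iff Δ Θ).2 ⟨M, c1, c2, ⟨t, ht⟩, rfl⟩
    rw [hset] at hm
    rcases hm with hm | hm
    · exact Or.inl (by simpa using congrArg List.length hm)
    · exact Or.inr (by simpa using congrArg List.length hm)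
  have hne : M₁ ≠ M₂ := fun h => hxy (by rw [h])
  have main : (∃ t, n = 1 ∧ len Δ Θ 1 = 1 ∧ len Δ Θ 2 = 4 ∧ PalPrefix (letter Δ Θ) t 3) ∨
      ∃ d i j k, Chain Δ Θ n d i j k := by
    rcases Nat.lt_or_gt_of_ne hne with hlt | hlt
    · exact (exists_chain a1 hlt b2 ht₁ ht₂ hall).imp_left fun h => ⟨_, h⟩
    · exact (exists_chain b1 hlt a2 ht₂ ht₁ fun M t c1 c2 ht => (hall M t c1 c2 ht).symm).imp_left
        fun h => ⟨_, h⟩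
  rcases main with ⟨t, rfl, h1, h2, ht⟩ | ⟨d, i, j, k, c⟩
  · exact (false_of_len_one hnorm hr h1 h2 ht).elim
  · exact c.exists_endsInForm hnorm hr

end TernaryPseudo

/-! ### The regular form produces a chain -/

namespace TernaryPseudo
open Anti

variable {Δ : Stream' Letter} {Θ : Stream' Anti} {n d q : ℕ} {i j k a b₁ b₂ b₃ : Letter}

theorem suffix_take {α : Type} {s : Stream' α} {N : ℕ} {a b c d : α}
    (h : [a, b, c, d] <:+ s.take N) :
    ∃ q, N = q + 4 ∧ s.get q = a ∧ s.get (q + 1) = b ∧ s.get (q + 2) = c ∧ s.get (q + 3) = d := by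
  obtain ⟨u, hu⟩ := h
  have hl := congrArg List.length hu
  simp only [List.length_append, List.length_cons, List.length_nil, Stream'.length_take] at hl
  refine ⟨N - 4, by omega, ?_⟩
  obtain ⟨q, rfl⟩ : ∃ q, N = q + 4 := ⟨N - 4, by omega⟩
  simp only [Stream'.take_succ', List.append_assoc, List.cons_append, List.nil_append] at hu
  have := (List.append_inj hu (by simp; omega)).2
  simp only [List.cons.injEq, and_true] at this
  obtain ⟨h1, h2, h3, h4⟩ := this
  exact ⟨h1.symm, h2.symm, h3.symm, h4.symm⟩

theorem form_letters : ∀ i j k : Letter, i ≠ j → i ≠ k → j ≠ k → ∀ b₁ b₂ b₃ : Letter,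
    (E i).onLetter b₁ = (E j).onLetter b₂ → (E j).onLetter b₂ = (E k).onLetter b₃ →
    b₂ = (E j).onLetter ((E i).onLetter b₁) ∧ b₃ = (E j).onLetter ((E i).onLetter b₂) ∧
    b₁ = (E j).onLetter ((E i).onLetter b₃) ∧ (E i).onLetter b₃ = (E j).onLetter b₁ := by decide

theorem twist_cube : ∀ i j : Letter, i ≠ j → ∀ x, (E j).onLetter ((E i).onLetter
    ((E j).onLetter ((E i).onLetter ((E j).onLetter ((E i).onLetter x))))) = x := by decide

/-- The square of E_jE_i conjugates E_j into E_k. This transfers statements about middle letters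
between the closures of w_{q+1} δ_{q+2} and w_{q+3} δ_{q+4}. -/
theorem fixed_iff : ∀ i j k : Letter, i ≠ j → i ≠ k → j ≠ k → ∀ b : Letter,
    (E k).onLetter ((E j).onLetter ((E i).onLetter ((E j).onLetter ((E i).onLetter b)))) =
      (E j).onLetter ((E i).onLetter ((E j).onLetter ((E i).onLetter b))) ↔
    (E j).onLetter b = b := by decide

theorem onLetter_eq_twist : ∀ i j k : Letter, i ≠ j → i ≠ k → j ≠ k → ∀ x,
    (E i).onLetter x = (E j).onLetter ((E i).onLetter ((E k).onLetter x)) ∧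
    (E k).onLetter x = (E j).onLetter ((E i).onLetter ((E j).onLetter x)) ∧
    (E j).onLetter x = (E k).onLetter ((E j).onLetter ((E i).onLetter x)) := by decide

/-- The four last terms of a bi-sequence that ends in the regular form. -/
structure RegularEnd (Δ : Stream' Letter) (Θ : Stream' Anti) (q : ℕ) (i j k : Letter) : Prop where
  ij : i ≠ j
  ik : i ≠ k
  jk : j ≠ k
  type₀ : Θ.get q = E i
  type₁ : Θ.get (q + 1) = E j
  type₂ : Θ.get (q + 2) = E k
  type₃ : Θ.get (q + 3) = E k
  letter₂ : Δ.get (q + 2) = (E j).onLetter ((E i).onLetter (Δ.get (q + 1)))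
  letter₃ : Δ.get (q + 3) = (E j).onLetter ((E i).onLetter (Δ.get (q + 2)))
  letter₁ : Δ.get (q + 1) = (E j).onLetter ((E i).onLetter (Δ.get (q + 3)))
  image : (E i).onLetter (Δ.get (q + 3)) = (E j).onLetter (Δ.get (q + 1))

theorem EndsInForm.regularEnd (h : EndsInForm Δ Θ (n + 1) i j k a b₁ b₂ b₃) :
    ∃ q, n = q + 3 ∧ RegularEnd Δ Θ q i j k ∧ Δ.get q = a ∧ Δ.get (q + 1) = b₁ ∧
      Δ.get (q + 2) = b₂ ∧ Δ.get (q + 3) = b₃ := by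
  obtain ⟨⟨hij, hik, hjk⟩, hΔ, hΘ, h1, h2⟩ := h
  obtain ⟨q, hq, d0, d1, d2, d3⟩ := suffix_take hΔ
  obtain ⟨q', hq', t0, t1, t2, t3⟩ := suffix_take hΘ
  obtain rfl : q' = q := by omega
  obtain ⟨e1, e2, e3, e4⟩ := form_letters i j k hij hik hjk b₁ b₂ b₃ h1 h2
  exact ⟨q', by omega, ⟨hij, hik, hjk, t0, t1, t2, t3, by rw [d2, d1]; exact e1,
    by rw [d3, d2]; exact e2, by rw [d1, d3]; exact e3, by rw [d1, d3]; exact e4⟩, d0, d1, d2, d3⟩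

namespace RegularEnd

/-- One inequality between the gaps is `gap_le`. For the other, `letter₂` extends the twisted period
`d` to the last letter of w_{q+2} δ_{q+3}, whose suffix from index `d - 1` on is then an `E
k`-palindrome. -/
theorem len_sub (h : RegularEnd Δ Θ q i j k) (hnorm : NormalizedPrefix Δ Θ (q + 3)) :
    len Δ Θ (q + 1) + len Δ Θ (q + 3) = len Δ Θ (q + 2) + len Δ Θ (q + 2) := by
  have l1 := len_lt_succ Δ Θ (q + 1)
  have l2 := len_lt_succ Δ Θ (q + 2)
  have p0 := palPrefix_len_succ Δ Θ q
  have p1 := palPrefix_len_succ Δ Θ (q + 1)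
  have p2 := palPrefix_len_succ Δ Θ (q + 2)
  rw [h.type₀] at p0
  rw [h.type₁] at p1
  have b1 := letter_len Δ Θ (q + 1)
  have b2 := letter_len Δ Θ (q + 2)
  have hle := len_succ_le Δ Θ (n := q + 2)
    (s := len Δ Θ (q + 2) - len Δ Θ (q + 1) - 1)
  obtain ⟨d, hd⟩ : ∃ d, len Δ Θ (q + 2) = len Δ Θ (q + 1) + d :=
    ⟨_, (Nat.add_sub_of_le l1.le).symm⟩
  obtain ⟨e, he⟩ : ∃ e, len Δ Θ (q + 3) = len Δ Θ (q + 2) + e :=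
    ⟨_, (Nat.add_sub_of_le l2.le).symm⟩
  have n1 : ∀ M t, len Δ Θ (q + 1) < M → M < len Δ Θ (q + 1) + d →
      ¬ PalPrefix (letter Δ Θ) t M :=
    fun M t h1 h2 => hnorm.not_palPrefix (m := q + 1) (by omega) h1 (by
      change M < len Δ Θ (q + 2); omega) t
  have hde := gap_le (N := len Δ Θ (q + 1)) (d := d) (e := e) (by rwa [← hd])
    (by rw [← hd, ← he]; exact p2) (by change _ < len Δ Θ (q + 3) at l2; omega) n1
  have st : ∀ m ≤ len Δ Θ (q + 1), letter Δ Θ (m + d) =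
      (E j).onLetter ((E i).onLetter (letter Δ Θ m)) := fun m hm => by
    rcases Nat.lt_or_ge m (len Δ Θ (q + 1)) with hlt | hge
    · exact p0.shift (by rw [← hd]; exact p1) hlt
    · obtain rfl : m = len Δ Θ (q + 1) := by omega
      rw [← hd, b2, b1, h.letter₂]
  have key : ∀ a b, d ≤ b → a + b + 1 = d + len Δ Θ (q + 2) →
      b ≤ len Δ Θ (q + 2) → letter Δ Θ a = (E k).onLetter (letter Δ Θ b) := fun a b h1 h2 h3 => by
    obtain ⟨m, rfl⟩ := Nat.exists_eq_add_of_le' h1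
    rw [st m (by omega), p1 a m (by change _ = len Δ Θ (q + 2); omega)]
    exact (onLetter_eq_twist i j k h.ij h.ik h.jk _).2.2
  have : len Δ Θ (q + 3) ≤ _ := hle (fun a b ha hb hab => by
    rw [h.type₂]
    change _ < len Δ Θ (q + 2) at l1
    rcases Nat.lt_or_ge b d with h1 | h1
    · rw [key b a (by omega) (by omega) (by omega), Anti.onLetter_onLetter]
    · exact key a b h1 (by omega) (by omega))
  change _ < len Δ Θ (q + 2) at l1
  omega

/-- The regular form produces a chain. -/
theorem exists_chain (h : RegularEnd Δ Θ q i j k) (hnorm : NormalizedPrefix Δ Θ (q + 3)) :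
    ∃ d, Chain Δ Θ (q + 3) d i j k := by
  have hq := le_len Δ Θ (q + 1)
  have l1 : len Δ Θ (q + 1) < len Δ Θ (q + 2) := len_lt_succ Δ Θ (q + 1)
  have l3 : len Δ Θ (q + 3) < len Δ Θ (q + 4) := len_lt_succ Δ Θ (q + 3)
  have p0 := palPrefix_len_succ Δ Θ q
  have p1 : PalPrefix (letter Δ Θ) _ (len Δ Θ (q + 2)) := palPrefix_len_succ Δ Θ (q + 1)
  have p2 : PalPrefix (letter Δ Θ) _ (len Δ Θ (q + 3)) := palPrefix_len_succ Δ Θ (q + 2)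
  have p3 : PalPrefix (letter Δ Θ) _ (len Δ Θ (q + 4)) := palPrefix_len_succ Δ Θ (q + 3)
  rw [h.type₀] at p0
  rw [h.type₁] at p1
  rw [h.type₂] at p2
  rw [h.type₃] at p3
  have b1 := letter_len Δ Θ (q + 1)
  have b2 := letter_len Δ Θ (q + 2)
  have b3 := letter_len Δ Θ (q + 3)
  have hsub := h.len_sub hnorm
  have t1 : len Δ Θ (q + 2) ≤ _ := len_succ_le_two_mul (q + 1)
  have t3 : len Δ Θ (q + 4) ≤ _ := len_succ_le_two_mul (q + 3)
  have c1 : ∀ s, _ → len Δ Θ (q + 2) ≤ _ := fun s => len_succ_le Δ Θ (n := q + 1) (s := s)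
  have c3 : ∀ s, _ → len Δ Θ (q + 4) ≤ _ := fun s => len_succ_le Δ Θ (n := q + 3) (s := s)
  rw [h.type₁] at c1
  rw [h.type₃] at c3
  have nk : ∀ m, q + 1 ≤ m → m < q + 3 → ¬ PalPrefix (letter Δ Θ) (E k) (len Δ Θ m) := by
    intro m hm1 hm2 hp
    obtain rfl | rfl : m = q + 1 ∨ m = q + 2 := by omega
    · have := hnorm.get_eq_E (by omega) hp
      rw [h.type₀] at this
      exact h.ik (Anti.E.inj this)
    · have := hnorm.get_eq_E (m := q + 1) (by omega) hp
      rw [h.type₁] at this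
      exact h.jk (Anti.E.inj this)
  have nb := fun N => hnorm.exists_len_eq (N := N) (t := E k)
  have hmono := len_strictMono Δ Θ
  have nbt : ∀ M t, len Δ Θ (q + 2) < M → M < len Δ Θ (q + 3) → ¬ PalPrefix (letter Δ Θ) t M :=
    fun M t h1 h2 => hnorm.not_palPrefix (m := q + 2) (by omega) h1 h2 t
  set U := letter Δ Θ
  obtain ⟨d, hd⟩ : ∃ d, len Δ Θ (q + 2) = len Δ Θ (q + 1) + d :=
    ⟨_, (Nat.add_sub_of_le l1.le).symm⟩
  obtain ⟨L, hL⟩ : ∃ L, len Δ Θ (q + 1) = L := ⟨_, rfl⟩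
  obtain ⟨T, hT⟩ : ∃ T, len Δ Θ (q + 4) = T := ⟨_, rfl⟩
  have hN : len Δ Θ (q + 3) = L + d + d := by omega
  rw [hL] at hd
  have nlt : ∀ m, len Δ Θ m ≥ L → len Δ Θ m < L + d + d → q + 1 ≤ m ∧ m < q + 3 := fun m h1 h2 =>
    ⟨hmono.le_iff_le.1 (by omega), hmono.lt_iff_lt.1 (by omega)⟩
  rw [hN] at p2 b3 l3 t3 c3 nbt nb
  rw [hT] at p3 l3 t3 c3
  rw [hd] at p1 b2 l1 t1 c1 nbt
  rw [hL] at p0 b1 l1 t1 c1 hq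
  have hbase : ∀ m ≤ L + d, U (m + d) = (E j).onLetter ((E i).onLetter (U m)) := fun m hm => by
    rcases Nat.lt_or_ge m (L + d) with hlt | hge
    · rw [p1.shift p2 hlt, (twist_eq i j k h.ij h.ik h.jk _).2]
    · obtain rfl : m = L + d := by omega
      rw [b3, b2, h.letter₃]
  have hx : U (L + d + d) = (E j).onLetter ((E i).onLetter ((E j).onLetter ((E i).onLetter
      (U L)))) := by
    rw [hbase _ le_rfl, hbase L (by omega)]
  -- The twist has order 3, so w_{q+3} δ_{q+4} has the ordinary period `3d` and its suffix from
  -- index `3d - 1` on is an `E k`-palindrome.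
  have hTle : T ≤ L + d + d + d + d + d := by
    have key : ∀ a b, d + d + d ≤ b → b ≤ L + d + d → a + b + 1 = L + d + d + d + d + d →
        U a = (E k).onLetter (U b) := fun a b h1 h2 h3 => by
      obtain ⟨m, rfl⟩ := Nat.exists_eq_add_of_le' h1
      rw [show m + (d + d + d) = m + d + d + d by omega, hbase (m + d + d) (by omega),
        hbase (m + d) (by omega), hbase m (by omega), twist_cube i j h.ij]
      exact p2 a m (by omega)
    have := c3 (d + d + d - 1) (fun a b ha hb hab => by
      rcases Nat.lt_or_ge b (d + d + d) with h1 | h1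
      · rcases Nat.lt_or_ge a (d + d + d) with h2 | h2
        · have e1 : a = L + d + d := by omega
          have e2 : b = L + d + d := by omega
          rw [e1, e2, hx]
          exact ((fixed_iff i j k h.ij h.ik h.jk _).2 (p1 L L (by omega)).symm).symm
        · rw [key b a h2 (by omega) (by omega), Anti.onLetter_onLetter]
      · exact key a b h1 (by omega) (by omega))
    omega
  have hTge : L + d + d + d + d + d ≤ T := by
    by_contra hlt
    obtain ⟨D, hD⟩ : ∃ D, T = L + d + d + D := ⟨_, (Nat.add_sub_of_le l3.le).symm⟩
    rw [hD] at p3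
    rcases Nat.lt_or_ge (L + d + d) D with hDN | hDN
    · have hfix := p3 (L + d + d) (L + d + d) (by omega)
      rw [hx] at hfix
      have hfix' := (fixed_iff i j k h.ij h.ik h.jk _).1 hfix.symm
      have := c1 L (fun a b ha hb hab => by
        rw [show a = L by omega, show b = L by omega, hfix'])
      omega
    · have pX : PalPrefix U (E k) (L + d + d - D) :=
        p2.reflect p3 hDN fun x => (by rw [Anti.onLetter_onLetter])
      rcases Nat.lt_or_ge (L + d + d - D) L with hXL | hXL
      · have sX : U (L + d + d - D) = U (L + d + d) := by
          have := p2.shift p3 (m := L + d + d - D) (by omega)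
          rw [Anti.onLetter_onLetter, show L + d + d - D + D = L + d + d by omega] at this
          exact this.symm
        obtain ⟨X, hX⟩ : ∃ X, L + d + d - D = X := ⟨_, rfl⟩
        rw [hX] at pX sX hXL
        have hend : U (L - X - 1) = (E j).onLetter (U L) := by
          rw [p0 (L - X - 1) X (by omega), sX, b3, b1]
          exact h.image
        have := c1 (L - X - 1) (fun a b ha hb hab => by
          rcases Nat.lt_or_ge a L with haL | haL
          · rcases Nat.lt_or_ge b L with hbL | hbL
            · rw [p0 a (L - 1 - a) (by omega), p0 b (L - 1 - b) (by omega),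
                pX (L - 1 - a) (L - 1 - b) (by omega)]
              exact (twist_eq i j k h.ij h.ik h.jk _).1
            · rw [show b = L by omega, show a = L - X - 1 by omega, hend]
          · rw [show a = L by omega, show b = L - X - 1 by omega, hend, Anti.onLetter_onLetter])
        omega
      · obtain ⟨m, -, hm⟩ := nb _ (by omega) pX
        obtain ⟨m1, m2⟩ := nlt m (by omega) (by omega)
        rw [hm] at pX
        exact nk m m1 m2 pX
  have hTeq : T = L + d + d + d + d + d := le_antisymm hTle hTge
  rw [hTeq] at p3
  -- `V` continues the first `d` letters with an exact twisted period. It agrees with `U` through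
  -- index |w_{q+3}| by `hbase`, and then up to |w_{q+4}| because both prefixes of that length are
  -- `E k`-palindromes.
  set V : ℕ → Letter := fun m => (fun x => (E j).onLetter ((E i).onLetter x))^[m / d] (U (m % d))
    with hV
  have hVs : ∀ m, V (m + d) = (E j).onLetter ((E i).onLetter (V m)) := fun m => by
    simp only [hV]
    rw [Nat.add_div_right _ (by omega), Nat.add_mod_right, Function.iterate_succ_apply']
  have hUV : ∀ m ≤ L + d + d, V m = U m := by
    intro m
    induction m using Nat.strong_induction_on with
    | _ m ih =>
      intro hm
      rcases Nat.lt_or_ge m d with h1 | h1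
      · simp only [hV]
        rw [Nat.div_eq_of_lt h1, Nat.mod_eq_of_lt h1]
        rfl
      · obtain ⟨m, rfl⟩ := Nat.exists_eq_add_of_le' h1
        rw [hVs, hbase m (by omega), ih m (by omega) (by omega)]
  have v0 : PalPrefix V (E k) (L + d + d) := p2.congr fun m hm => (hUV m hm.le).symm
  have v1 : PalPrefix V (E i) (L + d + d + d) := v0.extend (by omega)
    (fun x => (E j).onLetter ((E i).onLetter x)) (fun m _ => hVs m)
    fun x => (onLetter_eq_twist i j k h.ij h.ik h.jk x).1
  have v2 : PalPrefix V (E j) (L + d + d + d + d) := v1.extend (by omega)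
    (fun x => (E j).onLetter ((E i).onLetter x)) (fun m _ => hVs m)
    fun x => by rw [Anti.onLetter_onLetter]
  have v3 : PalPrefix V (E k) (L + d + d + d + d + d) := v2.extend (by omega)
    (fun x => (E j).onLetter ((E i).onLetter x)) (fun m _ => hVs m)
    fun x => (onLetter_eq_twist i j k h.ij h.ik h.jk x).2.1
  have hUV' : ∀ m < L + d + d + d + d + d, V m = U m := fun m hm => by
    rcases Nat.lt_or_ge (L + d + d) m with h1 | h1
    · rw [p3 m (L + d + d + d + d + d - 1 - m) (by omega),
        v3 m (L + d + d + d + d + d - 1 - m) (by omega), hUV _ (by omega)]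
    · exact hUV m h1
  refine ⟨d, h.ij, h.ik, h.jk, by omega, by omega, by omega, h.type₂, h.type₃, ?_, ?_, ?_, ?_, ?_,
    by omega, ?_⟩
  · rwa [hN]
  · rw [hN]; exact v1.congr fun m hm => hUV' m (by omega)
  · rw [hN]; exact v2.congr fun m hm => hUV' m (by omega)
  · rwa [hN]
  · rw [hN]; exact hT.trans hTeq
  · rw [hN]
    intro M t h1 h2 hM
    obtain ⟨f, rfl⟩ : ∃ f, M = L + d + d + f := ⟨_, (Nat.add_sub_of_le h1.le).symm⟩
    obtain ⟨s, hs⟩ := p2.exists_reflect hM (by omega)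
    exact nbt _ s (by omega) (by omega) hs

end RegularEnd

end TernaryPseudo

/-! ### Counting the missed prefixes and the factor rule -/

namespace TernaryPseudo
open Anti

/-- A shorter closure, of length `N + D` with `D < d`, would reflect at `N` to a pseudopalindromic
prefix of length `N - D`, where there is none. -/
theorem closure_take_eq {W : Stream' Letter} {s t : Anti} {N d : ℕ}
    (hs : PalPrefix W.get s N) (ht : PalPrefix W.get t (N + d)) (hd : 0 < d) (hdN : d ≤ N)
    (hno : ∀ M r, N - d < M → M < N → ¬ PalPrefix W.get r M) :
    closure t (W.take (N + 1)) = W.take (N + d) := by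
  set C := closure t (W.take (N + 1)) with hC
  have hpre : W.take (N + 1) <+: C := prefix_closure _ _
  have hpal := closure_isPal t (W.take (N + 1))
  rw [← hC, isPal_iff] at hpal
  have hle : C.length ≤ N + d := by
    have := closure_shortest t (W.take (N + 1)) (W.take (N + d)) ((isPal_take_iff W t _).2 ht)
      (Stream'.take_prefix_take_left _ _ _ (by omega))
    simpa using this
  have hge : N + 1 ≤ C.length := by simpa using hpre.length_le
  have hCW : ∀ m < N + 1, C.getD m 0 = W.get m := fun m hm => by
    rw [List.getD_eq_getElem _ _ (by omega), ← hpre.getElem (by simpa using hm), Stream'.take_get]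
  have hlen : C.length = N + d := by
    by_contra hne
    obtain ⟨D, hD⟩ : ∃ D, C.length = N + D := ⟨C.length - N, by omega⟩
    rw [hD] at hpal
    have hs' : PalPrefix (fun m => C.getD m 0) s N :=
      hs.congr fun m hm => (hCW m (by omega)).symm
    obtain ⟨r, hr⟩ := hs'.exists_reflect hpal (by omega)
    exact hno _ r (by omega) (by omega) (hr.congr fun m hm => hCW m (by omega))
  rw [hlen] at hpal
  apply List.ext_getElem (by simpa using hlen)
  intro m h1 h2
  rw [Stream'.take_get, ← List.getD_eq_getElem _ 0 h1]
  rcases Nat.lt_or_ge m (N + 1) with h | h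
  · exact hCW m h
  · have e1 := hpal m (N + d - 1 - m) (by omega)
    have e2 := ht m (N + d - 1 - m) (by omega)
    simp only at e1
    rw [e1, e2, hCW _ (by omega)]

variable {Δ Δ' : Stream' Letter} {Θ Θ' : Stream' Anti} {n d : ℕ} {i j k : Letter}

theorem w_congr {m : ℕ} (h : ∀ r < m, Δ'.get r = Δ.get r ∧ Θ'.get r = Θ.get r) :
    w Δ' Θ' m = w Δ Θ m := by
  induction m with
  | zero => rfl
  | succ m ih =>
    rw [w, w, ih fun r hr => h r (by omega), (h m (by omega)).1, (h m (by omega)).2]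

theorem w_add_congr {p q : ℕ} (hw : w Δ' Θ' p = w Δ Θ q)
    (h : ∀ r, Δ'.get (p + r) = Δ.get (q + r) ∧ Θ'.get (p + r) = Θ.get (q + r)) (r : ℕ) :
    w Δ' Θ' (p + r) = w Δ Θ (q + r) := by
  induction r with
  | zero => exact hw
  | succ r ih => rw [← add_assoc, ← add_assoc, w, w, ih, (h r).1, (h r).2]

theorem word_eq {p q : ℕ} (h : ∀ r, w Δ' Θ' (p + r) = w Δ Θ (q + r)) :
    word Δ' Θ' = word Δ Θ := by
  apply Stream'.ext
  intro m
  have h1 := take_word Δ' Θ' (p + (m + 1))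
  have h2 := take_word Δ Θ (q + (m + 1))
  have hl := le_length_w Δ' Θ' (p + (m + 1))
  rw [h, ← h2, Stream'.length_take] at h1
  have h3 := congrArg (fun l => l[m]?) h1
  rw [h] at hl
  simp only [Stream'.getElem?_take (show m < (w Δ Θ (q + (m + 1))).length by omega)] at h3
  exact Option.some.inj h3

section ReplaceFour

variable {α : Type} (s : Stream' α) (p : ℕ) (v : List α)

theorem get_replaceFour_of_lt {m : ℕ} (hm : m < p) : (replaceFour s p v).get m = s.get m := by
  rw [replaceFour, Stream'.append_append_stream, Stream'.get_append_left _ _ _ (by simpa using hm),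
    Stream'.take_get]

theorem get_replaceFour_add {m : ℕ} (hm : m < v.length) :
    (replaceFour s p v).get (p + m) = v[m] := by
  have := Stream'.get_append_right m (s.take p) (v ++ₛ s.drop (p + 4))
  rw [Stream'.length_take] at this
  rw [replaceFour, Stream'.append_append_stream, this, Stream'.get_append_left _ _ _ hm]

theorem get_replaceFour_add_length (m : ℕ) :
    (replaceFour s p v).get (p + v.length + m) = s.get (p + 4 + m) := by
  have := Stream'.get_append_right m (s.take p ++ v) (s.drop (p + 4))
  rw [List.length_append, Stream'.length_take] at this
  rw [replaceFour, this, Stream'.get_drop]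

end ReplaceFour

namespace Chain

/-- A prefix inside the second or third gap reflects into the previous gap, and so down to the
first, which is empty. -/
theorem eq_of_palPrefix (c : Chain Δ Θ n d i j k) {M : ℕ} {t : Anti} (h1 : len Δ Θ n < M)
    (h2 : M < len Δ Θ n + d + d + d) (hM : PalPrefix (letter Δ Θ) t M) :
    M = len Δ Θ n + d ∨ M = len Δ Θ n + d + d := by
  have hd := c.d_lt
  have g2 : ∀ f t, 0 < f → f < d → ¬ PalPrefix (letter Δ Θ) t (len Δ Θ n + d + f) := by
    intro f t h1 h2 hf
    obtain ⟨r, hr⟩ := c.pal₁.exists_reflect hf (by omega)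
    exact c.gap _ r (by omega) (by omega) hr
  rcases lt_trichotomy M (len Δ Θ n + d) with h | h | h
  · exact absurd hM (c.gap M t h1 h)
  · exact Or.inl h
  obtain ⟨f, rfl⟩ : ∃ f, M = len Δ Θ n + d + f := ⟨_, (Nat.add_sub_of_le h.le).symm⟩
  rcases lt_trichotomy f d with h' | h' | h'
  · exact absurd hM (g2 f t (by omega) h')
  · exact Or.inr (by rw [h'])
  · obtain ⟨g, rfl⟩ : ∃ g, f = d + g := ⟨_, (Nat.add_sub_of_le h'.le).symm⟩
    rw [← add_assoc] at hM
    obtain ⟨r, hr⟩ := c.pal₂.exists_reflect hM (by omega)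
    refine absurd ?_ (g2 (d - g) r (by omega) (by omega))
    rwa [show len Δ Θ n + d + (d - g) = len Δ Θ n + d + d - g by omega]

theorem missed_eq (c : Chain Δ Θ n d i j k) : missed Δ Θ n =
    {(word Δ Θ).take (len Δ Θ n + d), (word Δ Θ).take (len Δ Θ n + d + d)} := by
  have hd := c.d_pos
  have hT := c.len_succ
  ext x
  rw [mem_missed_iff, Set.mem_insert_iff, Set.mem_singleton_iff]
  constructor
  · rintro ⟨N, h1, h2, ⟨t, ht⟩, rfl⟩
    rcases c.eq_of_palPrefix h1 (by omega) ht with rfl | rfl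
    · exact Or.inl rfl
    · exact Or.inr rfl
  · rintro (rfl | rfl)
    · exact ⟨_, by omega, by omega, ⟨_, c.pal₁⟩, rfl⟩
    · exact ⟨_, by omega, by omega, ⟨_, c.pal₂⟩, rfl⟩

theorem ncard_missed (c : Chain Δ Θ n d i j k) : (missed Δ Θ n).ncard = 2 := by
  rw [c.missed_eq, Set.ncard_pair]
  intro h
  have := congrArg List.length h
  have := c.d_pos
  simp only [Stream'.length_take] at *
  omega

end Chain

/-- The factor rule: the missed prefixes can be inserted into the directive bi-sequence. -/
theorem Chain.factor_rule {q : ℕ} (c : Chain Δ Θ (q + 3) d i j k) (h : RegularEnd Δ Θ q i j k)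
    (hnorm : NormalizedPrefix Δ Θ (q + 3))
    (hlt : ∀ m < q + 4, Δ'.get m = Δ.get m) (hlt' : ∀ m < q + 3, Θ'.get m = Θ.get m)
    (d4 : Δ'.get (q + 4) = Δ.get (q + 1)) (d5 : Δ'.get (q + 5) = Δ.get (q + 2))
    (t3 : Θ'.get (q + 3) = E i) (t4 : Θ'.get (q + 4) = E j) (t5 : Θ'.get (q + 5) = E k)
    (htail : ∀ r, Δ'.get (q + 6 + r) = Δ.get (q + 4 + r) ∧ Θ'.get (q + 6 + r) = Θ.get (q + 4 + r)) :
    w Δ' Θ' (q + 6) = w Δ Θ (q + 4) ∧ NormalizedPrefix Δ' Θ' (q + 6) ∧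
      missed Δ Θ (q + 3) = {w Δ' Θ' (q + 4), w Δ' Θ' (q + 5)} ∧ word Δ' Θ' = word Δ Θ := by
  have hd := c.d_lt
  have hd0 := c.d_pos
  have hw : ∀ m ≤ q + 3, w Δ' Θ' m = w Δ Θ m := fun m hm =>
    w_congr fun r hr => ⟨hlt r (by omega), hlt' r (by omega)⟩
  have hpred : len Δ Θ (q + 2) + d = len Δ Θ (q + 3) := c.len_pred hnorm
  have hU3 : (word Δ Θ).get (len Δ Θ (q + 3)) = Δ.get (q + 3) := letter_len Δ Θ (q + 3)
  have hU4 : (word Δ Θ).get (len Δ Θ (q + 3) + d) = Δ.get (q + 1) := by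
    have := c.shift (m := len Δ Θ (q + 3)) (by omega)
    rwa [letter_len, ← h.letter₁] at this
  have hU5 : (word Δ Θ).get (len Δ Θ (q + 3) + d + d) = Δ.get (q + 2) := by
    have := c.shift (m := len Δ Θ (q + 3) + d) (by omega)
    rwa [show letter Δ Θ (len Δ Θ (q + 3) + d) = Δ.get (q + 1) from hU4, ← h.letter₂] at this
  have e4 : w Δ' Θ' (q + 4) = (word Δ Θ).take (len Δ Θ (q + 3) + d) := by
    rw [w, t3, hw _ le_rfl, hlt _ (by omega), ← take_len, ← hU3, ← Stream'.take_succ']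
    exact closure_take_eq c.pal₀ c.pal₁ hd0 hd.le fun M t h1 h2 =>
      hnorm.not_palPrefix (m := q + 2) (by omega) (by omega) h2 t
  have e5 : w Δ' Θ' (q + 5) = (word Δ Θ).take (len Δ Θ (q + 3) + d + d) := by
    rw [w, t4, e4, d4, ← hU4, ← Stream'.take_succ']
    exact closure_take_eq c.pal₁ c.pal₂ hd0 (by omega) fun M t h1 h2 =>
      c.gap M t (by omega) h2
  have e6 : w Δ' Θ' (q + 6) = w Δ Θ (q + 4) := by
    rw [← take_len Δ Θ (q + 4), w, t5, e5, d5, ← hU5, ← Stream'.take_succ',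
      show len Δ Θ (q + 4) = _ from c.len_succ]
    refine closure_take_eq c.pal₂ c.pal₃ hd0 (by omega) fun M t h1 h2 hM => ?_
    have := c.eq_of_palPrefix (M := M) (t := t) (by omega) (by omega) hM
    omega
  have hT : len Δ Θ (q + 4) = len Δ Θ (q + 3) + d + d + d := c.len_succ
  refine ⟨e6, ⟨?_, ?_⟩, ?_, ?_⟩
  · rw [e6]
    rintro p hp ⟨t, ht⟩
    have hp' := eq_take_of_prefix Δ Θ hp
    have hpl : p.length ≤ len Δ Θ (q + 4) := hp.length_le
    rw [hp', isPal_take_word_iff] at ht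
    rcases Nat.lt_or_ge (len Δ Θ (q + 3)) p.length with h1 | h1
    · rcases Nat.lt_or_ge p.length (len Δ Θ (q + 4)) with h2 | h2
      · rcases c.eq_of_palPrefix h1 (by omega) ht with h3 | h3
        · exact ⟨q + 4, by omega, by rw [e4, ← h3, ← hp']⟩
        · exact ⟨q + 5, by omega, by rw [e5, ← h3, ← hp']⟩
      · refine ⟨q + 6, le_rfl, ?_⟩
        rw [e6, ← take_len, hp']
        congr 1
        omega
    · obtain ⟨m, hm, e⟩ := hnorm.exists_len_eq h1 ht
      exact ⟨m, by omega, by rw [hw m hm, ← take_len, ← e, ← hp']⟩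
  · intro x l hl hpre
    rw [e6] at hpre
    have hx : ∀ m < l, letter Δ Θ m = x := fun m hm => by
      have h1 := eq_take_of_prefix Δ Θ hpre
      have h2 := congrArg (fun v => v[m]?) h1
      simp only [List.length_replicate, Stream'.getElem?_take hm] at h2
      rw [List.getElem?_replicate_of_lt hm] at h2
      exact (Option.some.inj h2).symm
    -- A longer run of one letter would force equal types at positions `q` and `q + 1`, whereas
    -- these are `E i` and `E j`.
    have hln : l ≤ q + 3 := by
      by_contra hlt
      have key := hnorm.replicate (l := q + 3) le_rfl fun m hm => hx m (by omega)
      have k0 := key q (by omega)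
      have k1 := key (q + 1) (by omega)
      rw [h.type₀] at k0
      rw [h.type₁] at k1
      exact h.ij ((Anti.E.inj k0).trans (Anti.E.inj k1).symm)
    intro m hm
    rw [hlt' m (by omega)]
    exact hnorm.replicate hln hx m hm
  · rw [c.missed_eq, e4, e5]
  · exact word_eq (w_add_congr e6 htail)

end TernaryPseudo

theorem theorem4 (Δ : Stream' TernaryPseudo.Letter) (Θ : Stream' TernaryPseudo.Anti) (n : ℕ)
    (hnorm : TernaryPseudo.NormalizedPrefix Δ Θ n)
    (hrules : ∀ i j k : TernaryPseudo.Letter, i ≠ j → i ≠ k → j ≠ k →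
      ¬ TernaryPseudo.PrefixRule i j k (Δ.take (n + 1)) (Θ.take (n + 1))) :
    ((TernaryPseudo.missed Δ Θ n).ncard = 2 ↔
      ∃ i j k a b₁ b₂ b₃ : TernaryPseudo.Letter,
        TernaryPseudo.EndsInForm Δ Θ (n + 1) i j k a b₁ b₂ b₃) ∧
    (∀ i j k a b₁ b₂ b₃ : TernaryPseudo.Letter,
      TernaryPseudo.EndsInForm Δ Θ (n + 1) i j k a b₁ b₂ b₃ →
      ∀ (Δ' : Stream' TernaryPseudo.Letter) (Θ' : Stream' TernaryPseudo.Anti),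
        Δ' = TernaryPseudo.replaceFour Δ (n - 3) [a, b₁, b₂, b₃, b₁, b₂] →
        Θ' = TernaryPseudo.replaceFour Θ (n - 3)
          [.E i, .E j, .E k, .E i, .E j, .E k] →
        TernaryPseudo.w Δ' Θ' (n + 3) = TernaryPseudo.w Δ Θ (n + 1) ∧
        TernaryPseudo.NormalizedPrefix Δ' Θ' (n + 3) ∧
        TernaryPseudo.missed Δ Θ n =
          {TernaryPseudo.w Δ' Θ' (n + 1), TernaryPseudo.w Δ' Θ' (n + 2)} ∧
        TernaryPseudo.word Δ' Θ' = TernaryPseudo.word Δ Θ) := by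
  refine ⟨⟨TernaryPseudo.exists_endsInForm_of_ncard_eq_two hnorm hrules, ?_⟩, ?_⟩
  · rintro ⟨i, j, k, a, b₁, b₂, b₃, h⟩
    obtain ⟨q, rfl, hr, -⟩ := h.regularEnd
    obtain ⟨d, c⟩ := hr.exists_chain hnorm
    exact c.ncard_missed
  · rintro i j k a b₁ b₂ b₃ h Δ' Θ' hΔ hΘ
    obtain ⟨q, rfl, hr, rfl, rfl, rfl, rfl⟩ := h.regularEnd
    obtain ⟨d, c⟩ := hr.exists_chain hnorm
    rw [Nat.add_sub_cancel] at hΔ hΘ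
    subst hΔ hΘ
    have gΔ := fun m hm => TernaryPseudo.get_replaceFour_add Δ q (m := m)
      [Δ.get q, Δ.get (q + 1), Δ.get (q + 2), Δ.get (q + 3), Δ.get (q + 1), Δ.get (q + 2)] hm
    have gΘ := fun m hm => TernaryPseudo.get_replaceFour_add Θ q (m := m)
      [.E i, .E j, .E k, .E i, .E j, .E k] hm
    refine c.factor_rule hr hnorm (fun m hm => ?_) (fun m hm => ?_) (gΔ 4 (by simp))
      (gΔ 5 (by simp)) (gΘ 3 (by simp)) (gΘ 4 (by simp)) (gΘ 5 (by simp)) fun r =>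
        ⟨TernaryPseudo.get_replaceFour_add_length Δ q _ r,
          TernaryPseudo.get_replaceFour_add_length Θ q _ r⟩
    · rcases Nat.lt_or_ge m q with h1 | h1
      · exact TernaryPseudo.get_replaceFour_of_lt _ _ _ h1
      · obtain rfl | rfl | rfl | rfl : m = q ∨ m = q + 1 ∨ m = q + 2 ∨ m = q + 3 := by omega
        · exact gΔ 0 (by simp)
        · exact gΔ 1 (by simp)
        · exact gΔ 2 (by simp)
        · exact gΔ 3 (by simp)
    · rcases Nat.lt_or_ge m q with h1 | h1
      · exact TernaryPseudo.get_replaceFour_of_lt _ _ _ h1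
      · obtain rfl | rfl | rfl : m = q ∨ m = q + 1 ∨ m = q + 2 := by omega
        · rw [hr.type₀]; exact gΘ 0 (by simp)
        · rw [hr.type₁]; exact gΘ 1 (by simp)
        · rw [hr.type₂]; exact gΘ 2 (by simp)
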